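/- **Setting.** Let $D$ be a probability distribution of labelled examples $(x,y)\in\mathbb{R}^d\times\mathcal{Y}$ with $\|x\|\le 1$ almost surely. Let $\ell(p,y)\ge 0$ be a (measurable) loss which, for every $y$, is convex and $\beta$-smooth in $p\in\mathbb{R}$, that is, differentiable with $\ell(p,y)\le \ell(q,y)+\ell'(q,y)(p-q)+\frac{\beta}{2}(p-q)^2$ for all $p,q$, where $\ell'$ is the derivative in the first argument. Let $\mathcal{H}\subseteq\{w\in\mathbb{R}^d:\|w\|\le R\}$ be a compact convex class of weight vectors of linear predictors $x\mapsto\langle w,x\rangle$ with $0\in\mathcal{H}$ (for instance the whole ball), $R>0$. Assume that the risk $\mathcal{L}(w)=\mathbb{E}_{(x,y)\sim D}[\ell(\langle w,x\rangle,y)]$ is finite and $\alpha$-strongly convex on $\mathcal{H}$, where $\alpha,\beta>0$. Put $\kappa=\beta/\alpha$ and $\epsilon_{\rm opt}=\min_{w\in\mathcal{H}}\mathcal{L}(w)$, and let a target risk $\epsilon_{\rm prior}>0$ with $\epsilon_{\rm opt}\le\epsilon_{\rm prior}$ be known in advance. **ClippedSGD**, with parameters $\varepsilon,\tau\in(0,1)$,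 $\xi$, step size $\eta$ and integer stage size $T_1$. Start with $\widehat w_1=0$, $\Delta_1=R$. In stage $k=1,2,\dots$ put $\gamma_k=2\xi\beta\Delta_k$, $\mathcal{H}_k=\{w\in\mathcal{H}:\|w-\widehat w_k\|\le\Delta_k\}$ and $w_k^1=\widehat w_k$; for $t=1,\dots,T_1$ take a fresh example $(x,y)$, let $g=\ell'(\langle w_k^t,x\rangle,y)\,x$, clip it coordinatewise to $v_i=\operatorname{sign}(g_i)\min(\gamma_k,|g_i|)$, and set $w_k^{t+1}=\Pi_{\mathcal{H}_k}(w_k^t-\eta v)$, where $\Pi_{\mathcal H_k}$ is the Euclidean projection. Then put $\widehat w_{k+1}=\frac1{T_1}\sum_{t=1}^{T_1}w_k^t$ and $\Delta_{k+1}=\sqrt{\varepsilon\Delta_k^2+\frac{2\tau}{\beta}\epsilon_{\rm prior}}$. The examples are i.i.d. with distribution $D$; $m$ stages use $mT_1$ of them. **Theorem (convergence rate).** Let $\varepsilon,\tau,\delta\in(0,1)$ and $m\ge 1$, and let $$\xi=\frac{4\beta}{\alpha\tau},\qquad \eta=\frac{1}{2\xi\beta\sqrt{T_1}},\qquad s=\max\Big\{1,\Big\lceil\log_2\frac{\xi\beta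 R^2}{\epsilon_{\rm prior}}\Big\rceil\Big\},$$ and let $T_1$ be any integer with $$T_1\ \ge\ 4\max\Big\{\frac{\xi^3\beta d+2\xi\beta\sqrt d}{\varepsilon\alpha}\ln\frac{ms}{\delta},\ \frac{16\xi^2\beta^2}{\alpha^2\varepsilon^2}\Big\}.$$ Then, with probability at least $1-\delta$, the output after $m$ stages satisfies $$\mathcal{L}(\widehat w_{m+1})\le\frac{\beta R^2}{2}\varepsilon^m+\Big(1+\frac{\tau}{1-\varepsilon}\Big)\epsilon_{\rm prior}.$$ **Corollary (sample complexity).** For every $c>0$ there is $\tau\in(0,1)$ such that for every $B>0$ there is a constant $C>0$, depending only on $c$ and $B$, with the following property. Let $\varepsilon=\frac12$, $\beta R^2\le B$, $0<\epsilon_{\rm prior}\le\frac1{16}$, $\delta\in(0,1)$, and let $T$ be an integer with $$T\ \ge\ C\,d\,\kappa^4\,\log\frac1{\epsilon_{\rm prior}}\Big(\log\log\frac1{\epsilon_{\rm prior}}+\log\frac1\delta\Big).$$ Then one can choose $m$ and $T_1$ with $mT_1\le T$, knowing only $d,\alpha,\beta,R,\epsilon_{\rm prior},\delta,T,c,B$,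 such that for every problem as above ClippedSGD with this $\tau$, with $\xi=\frac{4\beta}{\alpha\tau}$ and $\eta=\frac1{2\xi\beta\sqrt{T_1}}$, satisfies $\mathcal{L}(\widehat w_{m+1})\le(1+c)\,\epsilon_{\rm prior}$ with probability at least $1-\delta$. -/

import Mathlib

open MeasureTheory ProbabilityTheory

/-- The Euclidean space `ℝ^d` of weight vectors and instances. -/
abbrev Vec (d : ℕ) : Type := EuclideanSpace ℝ (Fin d)

/-- A differentiable function `f : ℝ → ℝ` is `β`-smooth if it lies below all its
quadratic models with curvature `β`. -/
def IsSmoothLoss (β : ℝ) (f : ℝ → ℝ) : Prop :=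
  Differentiable ℝ f ∧ ∀ p q : ℝ, f p ≤ f q + deriv f q * (p - q) + β / 2 * (p - q) ^ 2

/-- The risk (expected loss) of the linear predictor `x ↦ ⟪w, x⟫` under the distribution `D`
of the labelled examples `(x, y)`. -/
noncomputable def risk {d : ℕ} {Y : Type*} [MeasurableSpace Y]
    (D : Measure (Vec d × Y)) (loss : ℝ → Y → ℝ) (w : Vec d) : ℝ :=
  ∫ z, loss (inner ℝ w z.1) z.2 ∂D

/-- The optimal risk over the hypothesis class `H`. -/
noncomputable def optRisk {d : ℕ} {Y : Type*} [MeasurableSpace Y]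
    (D : Measure (Vec d × Y)) (loss : ℝ → Y → ℝ) (H : Set (Vec d)) : ℝ :=
  sInf (risk D loss '' H)

/-- The standing assumptions: linear predictors with weights in a compact convex class `H`
inside the ball of radius `R` that contains the origin, instances in the unit ball, a
non-negative loss that is convex and `β`-smooth in the prediction and has finite expectation,
and an expected loss that is `α`-strongly convex on `H`. -/
structure IsLearningProblem {d : ℕ} {Y : Type*} [MeasurableSpace Y]
    (D : Measure (Vec d × Y)) (loss : ℝ → Y → ℝ) (H : Set (Vec d)) (R α β : ℝ) : Prop where
  prob : IsProbabilityMeasure D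
  unit_ball : ∀ᵐ z ∂D, ‖z.1‖ ≤ 1
  loss_measurable : Measurable (Function.uncurry loss)
  loss_nonneg : ∀ p y, 0 ≤ loss p y
  loss_convex : ∀ y, ConvexOn ℝ Set.univ (fun p => loss p y)
  loss_smooth : ∀ y, IsSmoothLoss β (fun p => loss p y)
  compact : IsCompact H
  zero_mem : (0 : Vec d) ∈ H
  bounded : ∀ w ∈ H, ‖w‖ ≤ R
  loss_integrable : ∀ w ∈ H, Integrable (fun z : Vec d × Y => loss (inner ℝ w z.1) z.2) D
  -- Convexity of `H` is part of `StrongConvexOn`.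
  risk_strongConvex : StrongConvexOn H α (risk D loss)

/-- `Z 0, Z 1, …` are independent examples, each with distribution `D`. -/
structure IsIIDSample {Ω S : Type*} [MeasurableSpace Ω] [MeasurableSpace S]
    (P : Measure Ω) (D : Measure S) (Z : ℕ → Ω → S) : Prop where
  measurable : ∀ i, Measurable (Z i)
  indep : iIndepFun Z P
  law : ∀ i, P.map (Z i) = D

/-- The metric projection of `u` onto `K`: a point of `K` nearest to `u`. -/
noncomputable def metricProj {d : ℕ} (K : Set (Vec d)) (u : Vec d) : Vec d :=
  Classical.epsilon fun v => v ∈ K ∧ ∀ w ∈ K, dist u v ≤ dist u w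

/-- On a nonempty closed set the projection is indeed a nearest point. -/
theorem metricProj_spec {d : ℕ} {K : Set (Vec d)} (hK : IsClosed K) (hne : K.Nonempty)
    (u : Vec d) : metricProj K u ∈ K ∧ ∀ w ∈ K, dist u (metricProj K u) ≤ dist u w := by
  have h : ∃ v, v ∈ K ∧ ∀ w ∈ K, dist u v ≤ dist u w := by
    obtain ⟨v, hv, hd⟩ := hK.exists_infDist_eq_dist hne u
    exact ⟨v, hv, fun w hw => hd ▸ Metric.infDist_le_dist_of_mem hw⟩
  exact Classical.epsilon_spec h

/-- The stochastic gradient `ℓ'(⟪w, x⟫, y) x` at `w` on the example `z = (x, y)`; the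
derivative is taken in the prediction. -/
noncomputable def stochGrad {d : ℕ} {Y : Type*} (loss : ℝ → Y → ℝ) (w : Vec d)
    (z : Vec d × Y) : Vec d :=
  deriv (fun p => loss p z.2) (inner ℝ w z.1) • z.1

/-- Coordinatewise clipping at level `γ`. -/
noncomputable def clip {d : ℕ} (γ : ℝ) (g : Vec d) : Vec d :=
  WithLp.toLp 2 fun i => Real.sign (g i) * min γ |g i|

/-- The input of ClippedSGD. -/
structure ClippedSGDInput where
  /-- step size `η` -/
  stepSize : ℝ
  /-- stage size `T₁` -/
  stageSize : ℕ
  /-- target risk -/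
  target : ℝ
  /-- contraction factor `ε` of the squared domain size -/
  eps : ℝ
  /-- the parameter `τ` of the domain size -/
  tau : ℝ
  /-- clipping parameter `ξ` -/
  xi : ℝ
  /-- smoothness constant `β` -/
  beta : ℝ
  /-- radius `R` of the hypothesis class -/
  radius : ℝ

namespace ClippedSGDInput

/-- The domain sizes: `Δ₁ = R` and `Δ_{k+1}² = ε Δ_k² + (2 τ / β) ε_prior`. Stages are counted
from `0` here, so `domainSize k` is `Δ_{k+1}`. -/
noncomputable def domainSize (A : ClippedSGDInput) : ℕ → ℝ
  | 0 => A.radius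
  | k + 1 => Real.sqrt (A.eps * A.domainSize k ^ 2 + 2 * A.tau / A.beta * A.target)

/-- The iterates within one stage: projected SGD with clipped gradients on the domain `K`,
clipping level `γ`, starting point `w₀`, on the examples `z 0, z 1, …`. -/
noncomputable def stageIterate {d : ℕ} {Y : Type*} (A : ClippedSGDInput) (loss : ℝ → Y → ℝ)
    (K : Set (Vec d)) (γ : ℝ) (w₀ : Vec d) (z : ℕ → Vec d × Y) : ℕ → Vec d
  | 0 => w₀
  | t + 1 =>
    metricProj K
      (A.stageIterate loss K γ w₀ z t
        - A.stepSize • clip γ (stochGrad loss (A.stageIterate loss K γ w₀ z t) (z t)))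

/-- The hypothesis returned by ClippedSGD after `m` stages on the stream of examples `z`; this is
`ŵ_{m+1}`, with `ŵ₁ = 0`. Each stage starts from the current hypothesis `ŵ`, works on
`{w ∈ H : ‖w - ŵ‖ ≤ Δ}` with clipping level `2 ξ β Δ`, consumes `T₁` fresh examples and returns
the average of its first `T₁` iterates. -/
noncomputable def output {d : ℕ} {Y : Type*} (A : ClippedSGDInput) (loss : ℝ → Y → ℝ)
    (H : Set (Vec d)) (z : ℕ → Vec d × Y) : ℕ → Vec d
  | 0 => 0
  | k + 1 =>
    (1 / (A.stageSize : ℝ)) • ∑ t ∈ Finset.range A.stageSize,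
      A.stageIterate loss {w ∈ H | ‖w - A.output loss H z k‖ ≤ A.domainSize k}
        (2 * A.xi * A.beta * A.domainSize k) (A.output loss H z k)
        (fun i => z (k * A.stageSize + i)) t

end ClippedSGDInput

/-- The clipping parameter `ξ = 4 β / (α τ)`. -/
noncomputable def xiParam (α β τ : ℝ) : ℝ := 4 * β / (α * τ)

/-- `s = ⌈log₂ (ξ β R² / ε_prior)⌉`, which is to be a positive integer. -/
noncomputable def sParam (α β R τ εprior : ℝ) : ℕ :=
  max 1 ⌈Real.logb 2 (xiParam α β τ * β * R ^ 2 / εprior)⌉₊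

/-- The (real) stage size `T₁` prescribed for `m` stages and confidence `1 - δ`. -/
noncomputable def stageSizeParam (d m : ℕ) (α β R τ ε εprior δ : ℝ) : ℝ :=
  4 * max
    ((xiParam α β τ ^ 3 * β * d + 2 * xiParam α β τ * β * Real.sqrt d) / (ε * α)
      * Real.log (m * sParam α β R τ εprior / δ))
    (16 * xiParam α β τ ^ 2 * β ^ 2 / (α ^ 2 * ε ^ 2))

/-- ClippedSGD with stage size `n`, `ξ = 4 β / (α τ)` and `η = 1 / (2 ξ β √n)`. -/
noncomputable def tunedInput (α β R τ ε εprior : ℝ) (n : ℕ) : ClippedSGDInput where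
  stepSize := 1 / (2 * xiParam α β τ * β * Real.sqrt n)
  stageSize := n
  target := εprior
  eps := ε
  tau := τ
  xi := xiParam α β τ
  beta := β
  radius := R

/-!
The proof compares each stage with the minimizer `u` of the risk `L` on `H`, and shows that with
high probability the stage shrinks the admissible distance to `u` from `Δ_k` to `Δ_{k+1}`.

*One step.* Let `v` be the clipped gradient at `w`, and let the progress of the step be
`p = ⟪v, w - u⟫ - η / 2 * ‖v‖²` (`stepProgress`). Since the loss is non-negative and `β`-smooth, the
squared gradient is at most `2 β` times the loss (`IsSmoothLoss.sq_deriv_le`). Hence the bias of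
clipping, the term `‖v‖²` and the second moment of `p` are all bounded by small multiples of the
loss itself, and convexity gives, example by example,
`-p + l p² ≤ loss u - (1 - 2 / ξ) loss w` with `l = 2 / (Δ² ξ³ β d)` (`stepProgress_bounds`).
Taking expectations, `exp (l ((1 - 2 / ξ) L w - L u - p))` has mean at most one
(`lintegral_exp_neg_stepProgress_le`).

*One stage.* The iterates depend on earlier examples only, so the products of these exponentials
have mean at most one (`IsIIDSample.lintegral_prod_le_one`), and Markov's inequality bounds the sum
of the exponents by `log (m / δ)` outside an event of probability `δ / m`
(`measure_stage_failure_le`). On the other hand the sum of the progress terms is at most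
`Δ² / (2 η)` by telescoping (`ClippedSGDInput.sum_stepProgress_le`). The two together bound the
excess risk of the average iterate by `α / 2 * Δ_{k+1}²` (`IsLearningProblem.excess_average_le`),
and strong convexity turns this into `‖ŵ_{k+1} - u‖ ≤ Δ_{k+1}`. A fixed exponent in the
supermartingale suffices, because the variance is charged to the loss; therefore the stage size
only has to grow with `log (m / δ)` and not with `s`, as in `one_sub_le_prob_risk_output`. This is
also what makes the sample complexity free of a factor `log log κ`.

The domain of a stage depends on the previous stages, so measurability of the iterates requires
that the projection onto `H ∩ closedBall a Δ` is continuous in the centre `a ∈ H` too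
(`continuousOn_metricProj`).
-/

/-! ### Smooth convex losses -/

/-- The self-bounding property of non-negative smooth functions: the step of length `|f' q| / β`
against the derivative cannot make `f` negative. -/
lemma IsSmoothLoss.sq_deriv_le {β : ℝ} {f : ℝ → ℝ} (h : IsSmoothLoss β f) (hβ : 0 < β)
    (hf : ∀ p, 0 ≤ f p) (q : ℝ) : deriv f q ^ 2 ≤ 2 * β * f q := by
  have h1 := h.2 (q - deriv f q / β) q
  have h2 := hf (q - deriv f q / β)
  have h3 : deriv f q * (q - deriv f q / β - q) + β / 2 * (q - deriv f q / β - q) ^ 2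
      = - (deriv f q ^ 2 / (2 * β)) := by
    field_simp
    ring
  have h4 : deriv f q ^ 2 / (2 * β) ≤ f q := by linarith
  rw [div_le_iff₀ (by positivity)] at h4
  linarith

lemma ConvexOn.sub_le_deriv_mul {f : ℝ → ℝ} (hc : ConvexOn ℝ Set.univ f)
    (hd : Differentiable ℝ f) (p q : ℝ) : f q - f p ≤ deriv f q * (q - p) := by
  rcases lt_trichotomy p q with h | h | h
  · have := hc.slope_le_deriv (Set.mem_univ p) (Set.mem_univ q) h (hd q)
    rw [slope_def_field, div_le_iff₀ (by linarith)] at this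
    linarith
  · simp [h]
  · have := hc.deriv_le_slope (Set.mem_univ q) (Set.mem_univ p) h (hd q)
    rw [slope_def_field, le_div_iff₀ (by linarith)] at this
    linarith

lemma IsSmoothLoss.le_of_abs_sub_le {β : ℝ} {f : ℝ → ℝ} (h : IsSmoothLoss β f) (hβ : 0 < β)
    (hf : ∀ p, 0 ≤ f p) {p q r : ℝ} (hpq : |p - q| ≤ r) :
    f p ≤ f q + (β * f q + 1 / 2) * r + β / 2 * r ^ 2 := by
  have h1 := h.2 p q
  have h2 := h.sq_deriv_le hβ hf q
  have hr : 0 ≤ r := (abs_nonneg _).trans hpq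
  have h3 : |deriv f q| ≤ β * f q + 1 / 2 := by
    nlinarith [sq_nonneg (|deriv f q| - 1), sq_abs (deriv f q)]
  have h4 : deriv f q * (p - q) ≤ (β * f q + 1 / 2) * r := by
    calc deriv f q * (p - q) ≤ |deriv f q * (p - q)| := le_abs_self _
      _ = |deriv f q| * |p - q| := abs_mul _ _
      _ ≤ (β * f q + 1 / 2) * r := by gcongr; exact (abs_nonneg _).trans h3
  have h5 : (p - q) ^ 2 ≤ r ^ 2 := by
    rw [← sq_abs]; gcongr
  nlinarith

/-! ### Clipping -/

section Clip

variable {d : ℕ} {γ : ℝ}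

lemma clip_apply (hγ : 0 ≤ γ) (g : Vec d) (i : Fin d) :
    clip γ g i = max (-γ) (min γ (g i)) := by
  simp only [clip]
  rcases lt_trichotomy (g i) 0 with h | h | h
  · rw [Real.sign_of_neg h, abs_of_neg h, min_eq_right (by linarith : g i ≤ γ)]
    rcases le_total γ (-g i) with h' | h'
    · rw [min_eq_left h', max_eq_left (by linarith)]; ring
    · rw [min_eq_right h', max_eq_right (by linarith)]; ring
  · simp [h, hγ]
  · rw [Real.sign_of_pos h, abs_of_pos h, one_mul, max_eq_right]
    exact le_min (by linarith) (by linarith)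

lemma continuous_clip (hγ : 0 ≤ γ) : Continuous (clip γ : Vec d → Vec d) := by
  have : (clip γ : Vec d → Vec d)
      = fun g => WithLp.toLp 2 fun i => max (-γ) (min γ (g i)) := by
    funext g
    ext i
    exact clip_apply hγ g i
  rw [this]
  fun_prop

lemma abs_clip_le (hγ : 0 ≤ γ) (g : Vec d) (i : Fin d) : |clip γ g i| ≤ γ := by
  rw [clip_apply hγ, abs_le]
  exact ⟨le_max_left _ _, max_le (by linarith) (min_le_left _ _)⟩

lemma abs_clip_le_abs (hγ : 0 ≤ γ) (g : Vec d) (i : Fin d) : |clip γ g i| ≤ |g i| := by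
  rw [clip_apply hγ, abs_le]
  constructor
  · exact le_max_of_le_right (le_min (by linarith [abs_nonneg (g i)]) (neg_abs_le _))
  · exact max_le (by linarith [abs_nonneg (g i)]) ((min_le_right _ _).trans (le_abs_self _))

lemma norm_clip_le (hγ : 0 ≤ γ) (g : Vec d) : ‖clip γ g‖ ≤ γ * √d := by
  rw [EuclideanSpace.norm_eq]
  apply Real.sqrt_le_iff.2 ⟨by positivity, ?_⟩
  calc ∑ i, ‖clip γ g i‖ ^ 2 ≤ ∑ _i : Fin d, γ ^ 2 := by
        gcongr with i
        exact abs_clip_le hγ g i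
    _ = (γ * √d) ^ 2 := by
        rw [mul_pow, Real.sq_sqrt (Nat.cast_nonneg d)]; simp [mul_comm]

lemma norm_clip_le_norm (hγ : 0 ≤ γ) (g : Vec d) : ‖clip γ g‖ ≤ ‖g‖ := by
  rw [EuclideanSpace.norm_eq, EuclideanSpace.norm_eq]
  gcongr with i
  exact abs_clip_le_abs hγ g i

/-- Clipping at level `γ` moves a number `a` by at most `(|a| - γ)⁺ ≤ a² / (4 γ)`; summing over the
coordinates, the bias of clipping is quadratic in the norm. -/
lemma norm_sub_clip_le (hγ : 0 < γ) (g : Vec d) : ‖g - clip γ g‖ ≤ ‖g‖ ^ 2 / (4 * γ) := by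
  have hi : ∀ i, ‖(g - clip γ g) i‖ ≤ g i ^ 2 / (4 * γ) := by
    intro i
    have h0 : 0 ≤ g i ^ 2 / (4 * γ) := by positivity
    have h1 : g i - γ ≤ g i ^ 2 / (4 * γ) := by
      rw [le_div_iff₀ (by positivity)]; nlinarith [sq_nonneg (g i - 2 * γ)]
    have h2 : - g i - γ ≤ g i ^ 2 / (4 * γ) := by
      rw [le_div_iff₀ (by positivity)]; nlinarith [sq_nonneg (g i + 2 * γ)]
    rw [PiLp.sub_apply, clip_apply hγ.le, Real.norm_eq_abs, abs_le]
    rcases max_cases (-γ) (min γ (g i)) with h | h <;>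
      rcases min_cases γ (g i) with h' | h' <;> constructor <;> linarith
  calc ‖g - clip γ g‖ = ‖∑ i, EuclideanSpace.single i ((g - clip γ g) i)‖ := by
        congr 1
        ext j
        simp [Finset.sum_apply, Pi.single_apply]
    _ ≤ ∑ i, ‖(g - clip γ g) i‖ := by
        refine (norm_sum_le _ _).trans (le_of_eq ?_)
        simp
    _ ≤ ∑ i, g i ^ 2 / (4 * γ) := Finset.sum_le_sum fun i _ => hi i
    _ = ‖g‖ ^ 2 / (4 * γ) := by
        rw [← Finset.sum_div, EuclideanSpace.norm_sq_eq]; simp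

end Clip

/-! ### Metric projections -/

section Projection

variable {d : ℕ} {H K : Set (Vec d)} {Δ : ℝ}

lemma inner_sub_sub_nonpos_of_nearest (hK : Convex ℝ K) {u v : Vec d} (hv : v ∈ K)
    (h : ∀ w ∈ K, dist u v ≤ dist u w) : ∀ w ∈ K, inner ℝ (u - v) (w - v) ≤ 0 := by
  rw [← norm_eq_iInf_iff_real_inner_le_zero hK hv]
  have : Nonempty K := ⟨⟨v, hv⟩⟩
  apply le_antisymm
  · exact le_ciInf fun w => by simpa [dist_eq_norm] using h w w.2
  · exact ciInf_le (f := fun w : K => ‖u - w‖) ⟨0, by rintro _ ⟨w, rfl⟩; positivity⟩ ⟨v, hv⟩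

lemma eq_of_nearest (hK : Convex ℝ K) {u v v' : Vec d} (hv : v ∈ K)
    (h : ∀ w ∈ K, dist u v ≤ dist u w) (hv' : v' ∈ K) (h' : ∀ w ∈ K, dist u v' ≤ dist u w) :
    v = v' := by
  have h1 := inner_sub_sub_nonpos_of_nearest hK hv h v' hv'
  have h2 := inner_sub_sub_nonpos_of_nearest hK hv' h' v hv
  have h3 : ‖v - v'‖ ^ 2 = inner ℝ (u - v) (v' - v) + inner ℝ (u - v') (v - v') := by
    rw [← real_inner_self_eq_norm_sq]
    simp only [inner_sub_left, inner_sub_right]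
    rw [real_inner_comm v v']
    ring
  have h4 : ‖v - v'‖ = 0 := by nlinarith [norm_nonneg (v - v')]
  exact sub_eq_zero.1 (norm_eq_zero.1 h4)

lemma norm_metricProj_sub_sq_le (hK : Convex ℝ K) (hc : IsClosed K) (u : Vec d) {w : Vec d}
    (hw : w ∈ K) : ‖metricProj K u - w‖ ^ 2 ≤ ‖u - w‖ ^ 2 := by
  obtain ⟨h1, h2⟩ := metricProj_spec hc ⟨w, hw⟩ u
  have h3 := inner_sub_sub_nonpos_of_nearest hK h1 h2 w hw
  set v := metricProj K u
  have h4 : u - w = (u - v) - (w - v) := by abel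
  rw [norm_sub_rev v w, h4, norm_sub_sq_real (u - v)]
  nlinarith [sq_nonneg ‖u - v‖]

lemma isClosed_sep_norm_sub_le (hH : IsClosed H) (a : Vec d) (Δ : ℝ) :
    IsClosed {w ∈ H | ‖w - a‖ ≤ Δ} :=
  hH.inter (isClosed_le (continuous_id.sub continuous_const).norm continuous_const)

lemma convex_sep_norm_sub_le (hH : Convex ℝ H) (a : Vec d) (Δ : ℝ) :
    Convex ℝ {w ∈ H | ‖w - a‖ ≤ Δ} := by
  convert hH.inter (convex_closedBall a Δ) using 1
  ext w
  simp [dist_eq_norm]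

/-- The projection of `u` onto `H ∩ closedBall a Δ` depends continuously on `(a, u)` jointly: its
graph is closed, because every point of `H ∩ closedBall a Δ` is a limit of points of the domains
with nearby centres `a' ∈ H` (move it slightly towards `a'`), and `H` is compact. -/
lemma continuousOn_metricProj (hH : IsCompact H) (hconv : Convex ℝ H) (hΔ : 0 < Δ) :
    ContinuousOn (fun p : Vec d × Vec d => metricProj {w ∈ H | ‖w - p.1‖ ≤ Δ} p.2)
      (H ×ˢ Set.univ) := by
  set F := fun p : Vec d × Vec d => metricProj {w ∈ H | ‖w - p.1‖ ≤ Δ} p.2 with hF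
  have hspec : ∀ p : Vec d × Vec d, p.1 ∈ H →
      F p ∈ {w ∈ H | ‖w - p.1‖ ≤ Δ} ∧ ∀ w ∈ {w ∈ H | ‖w - p.1‖ ≤ Δ},
        dist p.2 (F p) ≤ dist p.2 w := fun p hp =>
    metricProj_spec (isClosed_sep_norm_sub_le hH.isClosed _ _) ⟨p.1, hp, by simpa using hΔ.le⟩ _
  rintro ⟨a, u⟩ ⟨ha, -⟩
  rw [ContinuousWithinAt, Filter.tendsto_iff_ultrafilter]
  intro g hg
  have hgH : ∀ᶠ p in (g : Filter (Vec d × Vec d)), p.1 ∈ H :=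
    hg (Filter.mem_of_superset self_mem_nhdsWithin fun p hp => hp.1)
  have hgn : Filter.Tendsto id (g : Filter (Vec d × Vec d)) (nhds (a, u)) :=
    hg.trans nhdsWithin_le_nhds
  have hg1 : Filter.Tendsto (fun p : Vec d × Vec d => p.1) g (nhds a) := hgn.fst_nhds
  have hg2 : Filter.Tendsto (fun p : Vec d × Vec d => p.2) g (nhds u) := hgn.snd_nhds
  obtain ⟨y, hyH, hy⟩ := hH.ultrafilter_le_nhds (g.map F) (by
    simp only [Filter.le_principal_iff]
    exact hgH.mono fun p hp => (hspec p hp).1.1)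
  have hy : Filter.Tendsto F g (nhds y) := hy
  suffices h : y = F (a, u) by rwa [← h]
  refine eq_of_nearest (convex_sep_norm_sub_le hconv a Δ) (u := u) ⟨hyH, ?_⟩ ?_
    (hspec (a, u) ha).1 (hspec (a, u) ha).2
  · exact le_of_tendsto (hy.sub hg1).norm (hgH.mono fun p hp => (hspec p hp).1.2)
  · rintro w ⟨hwH, hwa⟩
    let θ : Vec d × Vec d → ℝ := fun p => Δ / (Δ + ‖p.1 - a‖)
    have hθ : Filter.Tendsto θ g (nhds 1) := by
      have : Filter.Tendsto θ g (nhds (Δ / (Δ + ‖a - a‖))) :=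
        tendsto_const_nhds.div (tendsto_const_nhds.add (hg1.sub tendsto_const_nhds).norm)
          (by simp [hΔ.ne'])
      simpa [hΔ.ne'] using this
    have hlim : Filter.Tendsto (fun p : Vec d × Vec d => dist p.2 (p.1 + θ p • (w - p.1))) g
        (nhds (dist u w)) := by
      have := hg2.dist (hg1.add (hθ.smul (tendsto_const_nhds (x := w) |>.sub hg1)))
      simpa using this
    refine le_of_tendsto_of_tendsto (hg2.dist hy) hlim (hgH.mono fun p hp => (hspec p hp).2 _ ?_)
    have hpos : 0 < Δ + ‖p.1 - a‖ := by positivity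
    have hθ0 : 0 ≤ θ p := by positivity
    have hθ1 : θ p ≤ 1 := by
      simp only [θ]
      rw [div_le_one hpos]
      linarith [norm_nonneg (p.1 - a)]
    refine ⟨hconv.add_smul_sub_mem hp hwH ⟨hθ0, hθ1⟩, ?_⟩
    rw [add_sub_cancel_left, norm_smul, Real.norm_of_nonneg hθ0]
    calc θ p * ‖w - p.1‖ ≤ θ p * (Δ + ‖p.1 - a‖) := by
          gcongr
          calc ‖w - p.1‖ = ‖(w - a) - (p.1 - a)‖ := by congr 1; abel
            _ ≤ ‖w - a‖ + ‖p.1 - a‖ := norm_sub_le _ _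
            _ ≤ Δ + ‖p.1 - a‖ := by gcongr
      _ = Δ := div_mul_cancel₀ _ hpos.ne'

end Projection

/-! ### Consequences of the standing assumptions -/

lemma abs_inner_le_norm_of_norm_le_one {d : ℕ} {w x : Vec d} (hx : ‖x‖ ≤ 1) :
    |inner ℝ w x| ≤ ‖w‖ :=
  (abs_real_inner_le_norm w x).trans (mul_le_of_le_one_right (norm_nonneg w) hx)

namespace IsLearningProblem

variable {d : ℕ} {Y : Type*} [MeasurableSpace Y] {D : Measure (Vec d × Y)}
  {loss : ℝ → Y → ℝ} {H : Set (Vec d)} {R α β : ℝ}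

lemma measurable_loss (h : IsLearningProblem D loss H R α β) :
    Measurable fun q : Vec d × (Vec d × Y) => loss (inner ℝ q.1 q.2.1) q.2.2 :=
  h.loss_measurable.comp ((measurable_fst.inner (𝕜 := ℝ) measurable_snd.fst).prodMk
    measurable_snd.snd)

lemma measurable_risk (h : IsLearningProblem D loss H R α β) : Measurable (risk D loss) := by
  have := h.prob
  exact (h.measurable_loss.stronglyMeasurable.integral_prod_right' (ν := D)).measurable

lemma measurable_stochGrad (h : IsLearningProblem D loss H R α β) :
    Measurable fun q : Vec d × (Vec d × Y) => stochGrad loss q.1 q.2 := by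
  -- The derivative is the pointwise limit of difference quotients with increments `1 / (n + 1)`.
  have hder : Measurable fun q : ℝ × Y => deriv (fun p => loss p q.2) q.1 := by
    refine measurable_of_tendsto_metrizable
      (f := fun (n : ℕ) (q : ℝ × Y) =>
        (1 / ((n : ℝ) + 1))⁻¹ * (loss (q.1 + 1 / ((n : ℝ) + 1)) q.2 - loss q.1 q.2)) ?_ ?_
    · intro n
      have h1 : Measurable fun q : ℝ × Y => loss (q.1 + 1 / ((n : ℝ) + 1)) q.2 :=
        h.loss_measurable.comp ((measurable_fst.add_const _).prodMk measurable_snd)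
      have h2 : Measurable fun q : ℝ × Y => loss q.1 q.2 := h.loss_measurable
      exact (h1.sub h2).const_mul _
    · rw [tendsto_pi_nhds]
      rintro ⟨p, y⟩
      have hd := ((h.loss_smooth y).1 p).hasDerivAt
      rw [hasDerivAt_iff_tendsto_slope_zero] at hd
      refine hd.comp (tendsto_nhdsWithin_iff.2 ⟨tendsto_one_div_add_atTop_nhds_zero_nat, ?_⟩)
      exact Filter.Eventually.of_forall fun n => by
        simp only [Set.mem_compl_iff, Set.mem_singleton_iff]
        positivity
  exact (hder.comp ((measurable_fst.inner (𝕜 := ℝ) measurable_snd.fst).prodMk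
    measurable_snd.snd)).smul measurable_snd.fst

lemma continuousOn_risk (h : IsLearningProblem D loss H R α β) (hβ : 0 < β) :
    ContinuousOn (risk D loss) H := by
  have := h.prob
  refine continuousOn_of_dominated
    (bound := fun z => loss (inner ℝ (0 : Vec d) z.1) z.2
      + (β * loss (inner ℝ (0 : Vec d) z.1) z.2 + 1 / 2) * R + β / 2 * R ^ 2) ?_ ?_ ?_ ?_
  · exact fun w hw => (h.loss_integrable w hw).aestronglyMeasurable
  · intro w hw
    filter_upwards [h.unit_ball] with z hz
    rw [Real.norm_of_nonneg (h.loss_nonneg _ _)]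
    refine (h.loss_smooth z.2).le_of_abs_sub_le hβ (fun p => h.loss_nonneg p _) ?_
    rw [inner_zero_left, sub_zero]
    exact (abs_inner_le_norm_of_norm_le_one hz).trans (h.bounded w hw)
  · have h0 := h.loss_integrable 0 h.zero_mem
    exact (h0.add (((h0.const_mul β).add (integrable_const _)).mul_const R)).add
      (integrable_const _)
  · refine Filter.Eventually.of_forall fun z => Continuous.continuousOn ?_
    exact (h.loss_smooth z.2).1.continuous.comp (continuous_id.inner continuous_const)

lemma exists_minimizer (h : IsLearningProblem D loss H R α β) (hβ : 0 < β) :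
    ∃ u ∈ H, IsMinOn (risk D loss) H u ∧ risk D loss u = optRisk D loss H := by
  obtain ⟨u, hu, hmin⟩ := h.compact.exists_isMinOn ⟨0, h.zero_mem⟩ (h.continuousOn_risk hβ)
  have hleast : IsLeast (risk D loss '' H) (risk D loss u) :=
    ⟨⟨u, hu, rfl⟩, by rintro _ ⟨w, hw, rfl⟩; exact hmin hw⟩
  exact ⟨u, hu, hmin, hleast.csInf_eq.symm⟩

lemma mul_norm_sub_sq_le (h : IsLearningProblem D loss H R α β) {u w : Vec d}
    (hu : u ∈ H) (hmin : IsMinOn (risk D loss) H u) (hw : w ∈ H) :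
    α / 2 * ‖w - u‖ ^ 2 ≤ risk D loss w - risk D loss u := by
  -- Strong convexity along the segment from `u` to `w`, divided by the parameter `s`.
  have key : ∀ s ∈ Set.Ioo (0 : ℝ) 1,
      (1 - s) * (α / 2 * ‖w - u‖ ^ 2) ≤ risk D loss w - risk D loss u := by
    rintro s ⟨hs0, hs1⟩
    have h1 := h.risk_strongConvex.2 hw hu hs0.le (by linarith : 0 ≤ 1 - s) (by ring)
    have h2 : risk D loss u ≤ risk D loss (s • w + (1 - s) • u) :=
      hmin (h.risk_strongConvex.1 hw hu hs0.le (by linarith : 0 ≤ 1 - s) (by ring))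
    simp only [smul_eq_mul] at h1
    refine le_of_mul_le_mul_left ?_ hs0
    nlinarith
  have hlim : Filter.Tendsto (fun s : ℝ => (1 - s) * (α / 2 * ‖w - u‖ ^ 2)) (nhdsWithin 0
      (Set.Ioi 0)) (nhds ((1 - 0) * (α / 2 * ‖w - u‖ ^ 2))) :=
    ((Continuous.tendsto (by fun_prop) 0).mono_left nhdsWithin_le_nhds)
  rw [sub_zero, one_mul] at hlim
  exact le_of_tendsto hlim (Filter.eventually_of_mem (Ioo_mem_nhdsGT one_pos) key)

/-- Unless `H` is trivial, the strong convexity constant is at most the smoothness constant: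
compare both at the midpoint of a segment `[0, w]`. -/
lemma strongConvexity_le_smoothness (h : IsLearningProblem D loss H R α β) (hβ : 0 < β)
    {w : Vec d} (hw : w ∈ H) (hw0 : w ≠ 0) : α ≤ β := by
  have := h.prob
  have h2 : (0 : ℝ) ≤ 1 / 2 := by norm_num
  have hmid : (1 / 2 : ℝ) • w + (1 / 2 : ℝ) • (0 : Vec d) ∈ H :=
    h.risk_strongConvex.1 hw h.zero_mem h2 h2 (by norm_num)
  have h1 := h.risk_strongConvex.2 hw h.zero_mem h2 h2 (by norm_num)
  have i1 := (h.loss_integrable w hw).const_mul (1 / 2)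
  have i2 := (h.loss_integrable 0 h.zero_mem).const_mul (1 / 2)
  have i3 := h.loss_integrable _ hmid
  have h3 : 1 / 2 * risk D loss w + 1 / 2 * risk D loss 0
      ≤ risk D loss ((1 / 2 : ℝ) • w + (1 / 2 : ℝ) • (0 : Vec d)) + β / 8 * ‖w‖ ^ 2 := by
    have : ∫ z, (1 / 2 * loss (inner ℝ w z.1) z.2
          + 1 / 2 * loss (inner ℝ (0 : Vec d) z.1) z.2) ∂D
        ≤ ∫ z, (loss (inner ℝ ((1 / 2 : ℝ) • w + (1 / 2 : ℝ) • (0 : Vec d)) z.1) z.2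
          + β / 8 * ‖w‖ ^ 2) ∂D := by
      refine integral_mono_ae (i1.add i2) (i3.add (integrable_const _)) ?_
      filter_upwards [h.unit_ball] with z hz
      have hs := (h.loss_smooth z.2).2
      simp only [inner_add_left, real_inner_smul_left, inner_zero_left, mul_zero, add_zero]
      set p : ℝ := inner ℝ w z.1
      have hp : p ^ 2 ≤ ‖w‖ ^ 2 := by
        rw [← sq_abs]
        gcongr
        exact abs_inner_le_norm_of_norm_le_one hz
      have b1 := hs p (1 / 2 * p)
      have b2 := hs 0 (1 / 2 * p)
      nlinarith
    rw [integral_add i1 i2, integral_add i3 (integrable_const _), integral_const_mul,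
      integral_const_mul] at this
    simpa [risk] using this
  simp only [smul_eq_mul, sub_zero] at h1
  have h4 : 0 < ‖w‖ ^ 2 := by have := norm_pos_iff.2 hw0; positivity
  refine le_of_mul_le_mul_right ?_ h4
  linarith

end IsLearningProblem

/-! ### The exponential moment of one step -/

/-- The progress of one step of SGD with clipped gradients at `w` towards `u` on the example `z`:
half of the decrease of the squared distance to `u` before projecting, divided by the step
size `η`. -/
noncomputable def stepProgress {d : ℕ} {Y : Type*} (loss : ℝ → Y → ℝ) (γ η : ℝ) (u w : Vec d)
    (z : Vec d × Y) : ℝ :=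
  inner ℝ (clip γ (stochGrad loss w z)) (w - u) - η / 2 * ‖clip γ (stochGrad loss w z)‖ ^ 2

section StepProgress

variable {d : ℕ} {Y : Type*} {loss : ℝ → Y → ℝ} {β ξ Δ r : ℝ} {u w : Vec d}
  {z : Vec d × Y}

/-- The progress of a step is at least the difference of the losses, up to a multiple `2 / ξ` of the
current loss. This multiple pays for the bias of clipping, for the squared step length, and for the
second moment of the progress with the weight `2 / (Δ² ξ³ β d)`: all three are at most quadratic in
the gradient, whose square is at most `2 β` times the loss. The weight is small enough for the
rescaled progress to stay in `[-1, 1]`. Here `r` stands for the square root of the stage size. -/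
lemma stepProgress_bounds (hβ : 0 < β) (hξ : 4 ≤ ξ) (hΔ : 0 < Δ) (hr : 4 ≤ r) (hd : 1 ≤ d)
    (hs : IsSmoothLoss β fun p => loss p z.2) (hc : ConvexOn ℝ Set.univ fun p => loss p z.2)
    (h0 : ∀ p, 0 ≤ loss p z.2) (hz : ‖z.1‖ ≤ 1) (hwu : ‖w - u‖ ≤ 2 * Δ) :
    |2 / (Δ ^ 2 * (ξ ^ 3 * β * d))
        * stepProgress loss (2 * ξ * β * Δ) (1 / (2 * ξ * β * r)) u w z| ≤ 1 ∧
    - stepProgress loss (2 * ξ * β * Δ) (1 / (2 * ξ * β * r)) u w z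
        + 2 / (Δ ^ 2 * (ξ ^ 3 * β * d))
          * stepProgress loss (2 * ξ * β * Δ) (1 / (2 * ξ * β * r)) u w z ^ 2
      ≤ loss (inner ℝ u z.1) z.2 - (1 - 2 / ξ) * loss (inner ℝ w z.1) z.2 := by
  have hd' : (1 : ℝ) ≤ d := by exact_mod_cast hd
  have hd0 : (0 : ℝ) < d := by linarith
  have hξ0 : 0 < ξ := by linarith
  have hr0 : 0 < r := by linarith
  have hγ : 0 < 2 * ξ * β * Δ := by positivity
  have hsd : 1 ≤ √(d : ℝ) := by rw [Real.le_sqrt] <;> norm_num [hd]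
  set g := stochGrad loss w z with hg
  set v := clip (2 * ξ * β * Δ) g with hv
  set A := loss (inner ℝ w z.1) z.2 with hA
  set A' := loss (inner ℝ u z.1) z.2 with hA'
  have hA0 : 0 ≤ A := h0 _
  have hg2 : ‖g‖ ^ 2 ≤ 2 * β * A := by
    have h1 : ‖g‖ ≤ |deriv (fun p => loss p z.2) (inner ℝ w z.1)| := by
      rw [hg, stochGrad, norm_smul, Real.norm_eq_abs]
      exact mul_le_of_le_one_right (abs_nonneg _) hz
    calc ‖g‖ ^ 2 ≤ |deriv (fun p => loss p z.2) (inner ℝ w z.1)| ^ 2 := by gcongr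
      _ ≤ 2 * β * A := by rw [sq_abs]; exact hs.sq_deriv_le hβ h0 _
  have hv2 : ‖v‖ ^ 2 ≤ 2 * β * A := by
    refine le_trans ?_ hg2
    gcongr
    exact norm_clip_le_norm hγ.le g
  have hvd : ‖v‖ ≤ 2 * ξ * β * Δ * √d := norm_clip_le hγ.le g
  -- First-order part: convexity of the loss and the bias of clipping.
  have hfirst : A - A' - A / (2 * ξ) ≤ inner ℝ v (w - u) := by
    have h1 : A - A' ≤ inner ℝ g (w - u) := by
      have := hc.sub_le_deriv_mul hs.1 (inner ℝ u z.1) (inner ℝ w z.1)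
      rw [hg, stochGrad, real_inner_smul_left, inner_sub_right, real_inner_comm w z.1,
        real_inner_comm u z.1]
      simpa using this
    have h2 : inner ℝ (g - v) (w - u) ≤ A / (2 * ξ) := by
      calc inner ℝ (g - v) (w - u) ≤ ‖g - v‖ * ‖w - u‖ := real_inner_le_norm _ _
        _ ≤ (2 * β * A / (4 * (2 * ξ * β * Δ))) * (2 * Δ) := by
            gcongr
            exact (norm_sub_clip_le hγ g).trans (by gcongr)
        _ = A / (2 * ξ) := by field_simp; ring
    rw [inner_sub_left] at h2
    linarith
  set η := 1 / (2 * ξ * β * r) with hη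
  have hη0 : 0 < η := by positivity
  set P := stepProgress loss (2 * ξ * β * Δ) η u w z with hP
  have hPdef : P = inner ℝ v (w - u) - η / 2 * ‖v‖ ^ 2 := rfl
  have hsecond : η / 2 * ‖v‖ ^ 2 ≤ A / (8 * ξ) := by
    calc η / 2 * ‖v‖ ^ 2 ≤ η / 2 * (2 * β * A) := by gcongr
      _ = A / (2 * ξ * r) := by rw [hη]; field_simp
      _ ≤ A / (2 * ξ * 4) := by gcongr
      _ = A / (8 * ξ) := by ring_nf
  have habs : |P| ≤ ‖v‖ * (17 / 8 * Δ * √d) := by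
    have h1 : |inner ℝ v (w - u)| ≤ ‖v‖ * (2 * Δ * √d) := by
      calc |inner ℝ v (w - u)| ≤ ‖v‖ * ‖w - u‖ := abs_real_inner_le_norm _ _
        _ ≤ ‖v‖ * (2 * Δ * 1) := by gcongr; linarith
        _ ≤ ‖v‖ * (2 * Δ * √d) := by gcongr
    have h2 : η / 2 * ‖v‖ ^ 2 ≤ ‖v‖ * (1 / 8 * Δ * √d) := by
      calc η / 2 * ‖v‖ ^ 2 = ‖v‖ * (η / 2 * ‖v‖) := by ring
        _ ≤ ‖v‖ * (η / 2 * (2 * ξ * β * Δ * √d)) := by gcongr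
        _ = ‖v‖ * (1 / (2 * r) * Δ * √d) := by rw [hη]; field_simp
        _ ≤ ‖v‖ * (1 / (2 * 4) * Δ * √d) := by gcongr
        _ = ‖v‖ * (1 / 8 * Δ * √d) := by norm_num
    rw [hPdef]
    calc |inner ℝ v (w - u) - η / 2 * ‖v‖ ^ 2|
        ≤ |inner ℝ v (w - u)| + |η / 2 * ‖v‖ ^ 2| := abs_sub _ _
      _ ≤ ‖v‖ * (2 * Δ * √d) + ‖v‖ * (1 / 8 * Δ * √d) := by
          rw [abs_of_nonneg (by positivity : 0 ≤ η / 2 * ‖v‖ ^ 2)]; gcongr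
      _ = ‖v‖ * (17 / 8 * Δ * √d) := by ring
  have hdd : √(d : ℝ) * √d = d := Real.mul_self_sqrt hd0.le
  constructor
  · rw [abs_mul, abs_of_nonneg (by positivity)]
    calc 2 / (Δ ^ 2 * (ξ ^ 3 * β * d)) * |P|
        ≤ 2 / (Δ ^ 2 * (ξ ^ 3 * β * d)) * ((2 * ξ * β * Δ * √d) * (17 / 8 * Δ * √d)) := by
          gcongr
          exact habs.trans (by gcongr)
      _ = 2 / (Δ ^ 2 * (ξ ^ 3 * β * d)) * (17 / 4 * ξ * β * Δ ^ 2 * (√d * √d)) := by ring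
      _ = 17 / 2 / ξ ^ 2 := by rw [hdd]; field_simp; norm_num
      _ ≤ 1 := by rw [div_le_one (by positivity)]; nlinarith
  · have hP2 : P ^ 2 ≤ 5 * Δ ^ 2 * d * (2 * β * A) := by
      calc P ^ 2 = |P| ^ 2 := (sq_abs P).symm
        _ ≤ (‖v‖ * (17 / 8 * Δ * √d)) ^ 2 := by gcongr
        _ = 289 / 64 * Δ ^ 2 * (√d * √d) * ‖v‖ ^ 2 := by ring
        _ ≤ 5 * Δ ^ 2 * d * (2 * β * A) := by rw [hdd]; gcongr; norm_num
    have hquad : 2 / (Δ ^ 2 * (ξ ^ 3 * β * d)) * P ^ 2 ≤ 5 / 4 * (A / ξ) := by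
      calc 2 / (Δ ^ 2 * (ξ ^ 3 * β * d)) * P ^ 2
          ≤ 2 / (Δ ^ 2 * (ξ ^ 3 * β * d)) * (5 * Δ ^ 2 * d * (2 * β * A)) := by gcongr
        _ = 20 / ξ ^ 2 * (A / ξ) := by field_simp; ring
        _ ≤ 20 / 4 ^ 2 * (A / ξ) := by gcongr
        _ = 5 / 4 * (A / ξ) := by norm_num
    have e1 : A / (2 * ξ) = 1 / 2 * (A / ξ) := by field_simp
    have e2 : A / (8 * ξ) = 1 / 8 * (A / ξ) := by field_simp
    have e3 : (1 - 2 / ξ) * A = A - 2 * (A / ξ) := by ring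
    have e4 : 0 ≤ A / ξ := by positivity
    rw [e3]
    rw [e1] at hfirst
    rw [e2] at hsecond
    linarith

/-- The exponential moment of the progress of one step, obtained from `stepProgress_bounds` by
`exp t ≤ 1 + t + t ^ 2` for `|t| ≤ 1`. -/
lemma lintegral_exp_neg_stepProgress_le [MeasurableSpace Y] {D : Measure (Vec d × Y)}
    {H : Set (Vec d)} {R α : ℝ} (h : IsLearningProblem D loss H R α β) (hβ : 0 < β) (hξ : 4 ≤ ξ)
    (hΔ : 0 < Δ) (hr : 4 ≤ r) (hd : 1 ≤ d) (hu : u ∈ H) (hw : w ∈ H) (hwu : ‖w - u‖ ≤ 2 * Δ) :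
    ∫⁻ z, ENNReal.ofReal (Real.exp (2 / (Δ ^ 2 * (ξ ^ 3 * β * d)) *
      ((1 - 2 / ξ) * risk D loss w - risk D loss u
        - stepProgress loss (2 * ξ * β * Δ) (1 / (2 * ξ * β * r)) u w z))) ∂D ≤ 1 := by
  have := h.prob
  set l := 2 / (Δ ^ 2 * (ξ ^ 3 * β * d)) with hl
  have hl0 : 0 ≤ l := by
    have : 0 < ξ := by linarith
    positivity
  set M := (1 - 2 / ξ) * risk D loss w - risk D loss u with hM
  let G : Vec d × Y → ℝ := fun z =>
    1 + l * (loss (inner ℝ u z.1) z.2 - (1 - 2 / ξ) * loss (inner ℝ w z.1) z.2)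
  have hGi : Integrable G D := (integrable_const _).add
    (((h.loss_integrable u hu).sub ((h.loss_integrable w hw).const_mul _)).const_mul _)
  have hG : ∀ᵐ z ∂D, Real.exp (-(l * stepProgress loss (2 * ξ * β * Δ)
      (1 / (2 * ξ * β * r)) u w z)) ≤ G z := by
    filter_upwards [h.unit_ball] with z hz
    obtain ⟨h1, h2⟩ := stepProgress_bounds hβ hξ hΔ hr hd (h.loss_smooth z.2)
      (h.loss_convex z.2) (fun p => h.loss_nonneg p z.2) hz hwu
    set P := stepProgress loss (2 * ξ * β * Δ) (1 / (2 * ξ * β * r)) u w z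
    have h3 := Real.abs_exp_sub_one_sub_id_le (x := -(l * P)) (by rwa [abs_neg])
    have h4 := mul_le_mul_of_nonneg_left h2 hl0
    have h5 := (abs_le.1 h3).2
    simp only [G]
    nlinarith
  have hint : ∫ z, G z ∂D = 1 - l * M := by
    have i1 := h.loss_integrable u hu
    have i2 := (h.loss_integrable w hw).const_mul (1 - 2 / ξ)
    have i3 : Integrable (fun z => l * (loss (inner ℝ u z.1) z.2
        - (1 - 2 / ξ) * loss (inner ℝ w z.1) z.2)) D := (i1.sub i2).const_mul l
    rw [integral_add (integrable_const _) i3, integral_const_mul, integral_sub i1 i2,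
      integral_const_mul]
    simp only [integral_const, probReal_univ, smul_eq_mul, hM, risk]
    ring
  calc ∫⁻ z, ENNReal.ofReal (Real.exp (l * (M - stepProgress loss (2 * ξ * β * Δ)
        (1 / (2 * ξ * β * r)) u w z))) ∂D
      ≤ ∫⁻ z, ENNReal.ofReal (Real.exp (l * M)) * ENNReal.ofReal (G z) ∂D := by
        refine lintegral_mono_ae ?_
        filter_upwards [hG] with z hz
        rw [← ENNReal.ofReal_mul (Real.exp_pos _).le, mul_sub, sub_eq_add_neg, Real.exp_add]
        gcongr
    _ = ENNReal.ofReal (Real.exp (l * M)) * ENNReal.ofReal (1 - l * M) := by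
        rw [lintegral_const_mul' _ _ ENNReal.ofReal_ne_top, ← hint,
          ofReal_integral_eq_lintegral_ofReal hGi]
        filter_upwards [hG] with z hz using (Real.exp_pos _).le.trans hz
    _ ≤ 1 := by
        rw [← ENNReal.ofReal_mul (Real.exp_pos _).le]
        refine ENNReal.ofReal_le_one.2 ?_
        have h1 := Real.add_one_le_exp (-(l * M))
        calc Real.exp (l * M) * (1 - l * M) ≤ Real.exp (l * M) * Real.exp (-(l * M)) := by
              gcongr; linarith
          _ = 1 := by rw [← Real.exp_add]; simp

end StepProgress

/-! ### Independence of the past and an exponential supermartingale -/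

/-- The `σ`-algebra generated by the examples `Z 0, …, Z (j - 1)`. -/
abbrev pastSigma {Ω S : Type*} [MeasurableSpace S] (Z : ℕ → Ω → S) (j : ℕ) : MeasurableSpace Ω :=
  ⨆ i ∈ Set.Iio j, MeasurableSpace.comap (Z i) inferInstance

lemma measurable_pastSigma {Ω S : Type*} [MeasurableSpace S] {Z : ℕ → Ω → S} {i j : ℕ}
    (hij : i < j) : Measurable[pastSigma Z j] (Z i) :=
  (comap_measurable (Z i)).mono (le_biSup (fun i => MeasurableSpace.comap (Z i) inferInstance) hij)
    le_rfl

lemma pastSigma_mono {Ω S : Type*} [MeasurableSpace S] {Z : ℕ → Ω → S} {i j : ℕ}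
    (hij : i ≤ j) : pastSigma Z i ≤ pastSigma Z j :=
  biSup_mono fun _ hk => lt_of_lt_of_le hk hij

section Past

variable {Ω S E : Type*} [MeasurableSpace Ω] [MeasurableSpace S] [MeasurableSpace E]
  {P : Measure Ω} {D : Measure S} {Z : ℕ → Ω → S}

lemma IsIIDSample.pastSigma_le (hZ : IsIIDSample P D Z) (j : ℕ) :
    pastSigma Z j ≤ (inferInstance : MeasurableSpace Ω) :=
  iSup₂_le fun i _ => (hZ.measurable i).comap_le

lemma IsIIDSample.indepFun_of_measurable_pastSigma (hZ : IsIIDSample P D Z) {j : ℕ} {G : Ω → E}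
    (hG : Measurable[pastSigma Z j] G) : IndepFun G (Z j) P := by
  rw [IndepFun_iff_Indep]
  have h := indep_iSup_of_disjoint (fun i => (hZ.measurable i).comap_le)
    ((iIndepFun_iff_iIndep _ _ _).1 hZ.indep) (S := Set.Iio j) (T := {j})
    (Set.disjoint_singleton_right.2 (lt_irrefl j))
  rw [iSup_singleton] at h
  exact indep_of_indep_of_le_left h hG.comap_le

/-- If `f w` has mean at most one under the law of a single example for every `w`, then so has the
product of the factors `f (W t) (Z (j + t))`, as long as `W t` depends on the earlier examples
only. -/
lemma IsIIDSample.lintegral_prod_le_one [IsProbabilityMeasure P] (hZ : IsIIDSample P D Z)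
    {f : E → S → ENNReal} (hf : Measurable (Function.uncurry f))
    (hf1 : ∀ w, ∫⁻ z, f w z ∂D ≤ 1) {W : ℕ → Ω → E} {j : ℕ}
    (hW : ∀ t, Measurable[pastSigma Z (j + t)] (W t)) (n : ℕ) :
    ∫⁻ ω, ∏ t ∈ Finset.range n, f (W t ω) (Z (j + t) ω) ∂P ≤ 1 := by
  have : IsProbabilityMeasure D := by
    rw [← hZ.law 0]; exact Measure.isProbabilityMeasure_map (hZ.measurable 0).aemeasurable
  induction n with
  | zero => simp
  | succ n ih =>
    let G : Ω → ENNReal × E :=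
      fun ω => (∏ t ∈ Finset.range n, f (W t ω) (Z (j + t) ω), W n ω)
    have hprod : Measurable[pastSigma Z (j + n)]
        fun ω => ∏ t ∈ Finset.range n, f (W t ω) (Z (j + t) ω) := by
      refine Finset.measurable_fun_prod _ fun t ht => ?_
      have ht' := Finset.mem_range.1 ht
      have h1 : Measurable[pastSigma Z (j + n)] (W t) :=
        (hW t).mono (pastSigma_mono (by omega)) le_rfl
      have h2 : Measurable[pastSigma Z (j + n)] (Z (j + t)) := measurable_pastSigma (by omega)
      exact hf.comp (h1.prodMk h2)
    have hG : Measurable[pastSigma Z (j + n)] G := hprod.prodMk (hW n)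
    have hG' : Measurable G := hG.mono (hZ.pastSigma_le _) le_rfl
    have hZn := hZ.measurable (j + n)
    have hlaw := (indepFun_iff_map_prod_eq_prod_map_map hG'.aemeasurable hZn.aemeasurable).1
      (hZ.indepFun_of_measurable_pastSigma hG)
    have := Measure.isProbabilityMeasure_map (μ := P) hG'.aemeasurable
    let F : (ENNReal × E) × S → ENNReal := fun q => q.1.1 * f q.1.2 q.2
    have hF : Measurable F := measurable_fst.fst.mul
      (hf.comp (measurable_fst.snd.prodMk measurable_snd))
    calc ∫⁻ ω, ∏ t ∈ Finset.range (n + 1), f (W t ω) (Z (j + t) ω) ∂P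
        = ∫⁻ ω, F (G ω, Z (j + n) ω) ∂P := by simp only [Finset.prod_range_succ, F, G]
      _ = ∫⁻ q, F q ∂((P.map G).prod D) := by
          rw [← hZ.law (j + n), ← hlaw, lintegral_map hF (hG'.prodMk hZn)]
      _ = ∫⁻ g, ∫⁻ z, g.1 * f g.2 z ∂D ∂(P.map G) := lintegral_prod _ hF.aemeasurable
      _ ≤ ∫⁻ g, g.1 ∂(P.map G) := by
          refine lintegral_mono fun g => ?_
          have hg : Measurable (f g.2) := hf.comp measurable_prodMk_left
          rw [lintegral_const_mul _ hg]
          exact mul_le_of_le_one_right' (hf1 g.2)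
      _ = ∫⁻ ω, ∏ t ∈ Finset.range n, f (W t ω) (Z (j + t) ω) ∂P :=
          lintegral_map measurable_fst hG'
      _ ≤ 1 := ih

end Past

/-! ### The iterates and the output -/

lemma measurable_metricProj {d : ℕ} {H : Set (Vec d)} {Δ : ℝ} (hH : IsCompact H)
    (hconv : Convex ℝ H) (hΔ : 0 < Δ) {Ω : Type*} [MeasurableSpace Ω] {a u : Ω → Vec d}
    (ha : Measurable a) (hu : Measurable u) (haH : ∀ ω, a ω ∈ H) :
    Measurable fun ω => metricProj {w ∈ H | ‖w - a ω‖ ≤ Δ} (u ω) := by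
  have hF := (continuousOn_iff_continuous_domRestrict.1
    (continuousOn_metricProj hH hconv hΔ)).measurable
  have hφ : Measurable fun ω =>
      (⟨(a ω, u ω), haH ω, Set.mem_univ _⟩ : (H ×ˢ (Set.univ : Set (Vec d)))) :=
    Measurable.subtype_mk (ha.prodMk hu)
  have hcomp := hF.comp hφ
  exact hcomp

namespace ClippedSGDInput

variable {d : ℕ} {Y : Type*} {A : ClippedSGDInput} {loss : ℝ → Y → ℝ} {H K : Set (Vec d)}
  {γ : ℝ} {w₀ u : Vec d}

lemma stageIterate_mem (hc : IsClosed K) (hw₀ : w₀ ∈ K) (z : ℕ → Vec d × Y) (t : ℕ) :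
    A.stageIterate loss K γ w₀ z t ∈ K := by
  cases t with
  | zero => exact hw₀
  | succ t => exact (metricProj_spec hc ⟨w₀, hw₀⟩ _).1

/-- The regret bound of projected gradient descent: the squared distances to `u` telescope. -/
lemma sum_stepProgress_le (hη : 0 < A.stepSize) (hK : Convex ℝ K) (hc : IsClosed K) (hu : u ∈ K)
    (z : ℕ → Vec d × Y) (n : ℕ) :
    ∑ t ∈ Finset.range n,
        stepProgress loss γ A.stepSize u (A.stageIterate loss K γ w₀ z t) (z t)
      ≤ ‖w₀ - u‖ ^ 2 / (2 * A.stepSize) := by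
  set w := A.stageIterate loss K γ w₀ z with hw
  have hstep : ∀ t, stepProgress loss γ A.stepSize u (w t) (z t)
      ≤ ‖w t - u‖ ^ 2 / (2 * A.stepSize) - ‖w (t + 1) - u‖ ^ 2 / (2 * A.stepSize) := by
    intro t
    have h1 := norm_metricProj_sub_sq_le hK hc
      (w t - A.stepSize • clip γ (stochGrad loss (w t) (z t))) hu
    have h2 : w (t + 1)
      = metricProj K (w t - A.stepSize • clip γ (stochGrad loss (w t) (z t))) := rfl
    rw [← h2, sub_right_comm, norm_sub_sq_real (w t - u), norm_smul, real_inner_smul_right,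
      real_inner_comm, mul_pow, Real.norm_eq_abs, sq_abs] at h1
    rw [← sub_div, le_div_iff₀ (by positivity), stepProgress]
    linarith
  calc _ ≤ ∑ t ∈ Finset.range n, (‖w t - u‖ ^ 2 / (2 * A.stepSize)
        - ‖w (t + 1) - u‖ ^ 2 / (2 * A.stepSize)) := Finset.sum_le_sum fun t _ => hstep t
    _ = ‖w 0 - u‖ ^ 2 / (2 * A.stepSize) - ‖w n - u‖ ^ 2 / (2 * A.stepSize) :=
        Finset.sum_range_sub' (fun t => ‖w t - u‖ ^ 2 / (2 * A.stepSize)) n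
    _ ≤ ‖w₀ - u‖ ^ 2 / (2 * A.stepSize) := by
        have : 0 ≤ ‖w n - u‖ ^ 2 / (2 * A.stepSize) := by positivity
        have h0 : w 0 = w₀ := rfl
        rw [h0]
        linarith

lemma average_mem (hK : Convex ℝ K) {w : ℕ → Vec d} (hw : ∀ t, w t ∈ K) {n : ℕ} (hn : 0 < n) :
    (1 / (n : ℝ)) • ∑ t ∈ Finset.range n, w t ∈ K := by
  rw [Finset.smul_sum]
  refine hK.sum_mem (fun _ _ => by positivity) ?_ fun t _ => hw t
  have : (n : ℝ) ≠ 0 := by positivity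
  simp [this]

lemma domainSize_pos (hR : 0 < A.radius) (hβ : 0 < A.beta) (hτ : 0 < A.tau) (hε : 0 < A.eps)
    (ht : 0 < A.target) (k : ℕ) : 0 < A.domainSize k := by
  induction k with
  | zero => exact hR
  | succ k ih => rw [domainSize]; positivity

lemma domainSize_succ_sq (hβ : 0 < A.beta) (hτ : 0 < A.tau) (hε : 0 < A.eps)
    (ht : 0 < A.target) (k : ℕ) :
    A.domainSize (k + 1) ^ 2 = A.eps * A.domainSize k ^ 2 + 2 * A.tau / A.beta * A.target := by
  rw [domainSize, Real.sq_sqrt (by positivity)]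

lemma domainSize_sq_le (hβ : 0 < A.beta) (hτ : 0 < A.tau) (hε : 0 < A.eps)
    (hε1 : A.eps < 1) (ht : 0 < A.target) (k : ℕ) :
    A.beta / 2 * A.domainSize k ^ 2
      ≤ A.beta * A.radius ^ 2 / 2 * A.eps ^ k + A.tau / (1 - A.eps) * A.target := by
  have h1 : 0 < 1 - A.eps := by linarith
  induction k with
  | zero =>
    have : 0 ≤ A.tau / (1 - A.eps) * A.target := by positivity
    simp only [domainSize, pow_zero]
    linarith
  | succ k ih =>
    rw [domainSize_succ_sq hβ hτ hε ht]
    have h2 : A.beta / 2 * (2 * A.tau / A.beta * A.target) = A.tau * A.target := by field_simp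
    have h3 : A.tau / (1 - A.eps) * A.target
        = A.eps * (A.tau / (1 - A.eps) * A.target) + A.tau * A.target := by
      field_simp
      ring
    have h4 := mul_le_mul_of_nonneg_left ih hε.le
    rw [pow_succ A.eps, mul_add, h2]
    linarith

lemma output_mem (hH : IsClosed H) (hconv : Convex ℝ H) (h0 : (0 : Vec d) ∈ H)
    (hΔ : ∀ k, 0 < A.domainSize k) (z : ℕ → Vec d × Y) (k : ℕ) : A.output loss H z k ∈ H := by
  induction k with
  | zero => exact h0
  | succ k ih =>
    rw [output]
    rcases Nat.eq_zero_or_pos A.stageSize with hn | hn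
    · simpa [hn] using h0
    · exact average_mem hconv (fun t =>
        (stageIterate_mem (isClosed_sep_norm_sub_le hH _ _) ⟨ih, by simpa using (hΔ k).le⟩
          _ t).1) hn

section Measurability

variable {Ω : Type*} [mΩ : MeasurableSpace Ω] [MeasurableSpace Y] {D : Measure (Vec d × Y)}
  {R α β : ℝ}

lemma measurable_stageIterate (h : IsLearningProblem D loss H R α β) {Δ : ℝ} (hΔ : 0 < Δ)
    (hγ : 0 ≤ γ) {w : Ω → Vec d} (hw : Measurable w) (hwH : ∀ ω, w ω ∈ H)
    {z : ℕ → Ω → Vec d × Y} (t : ℕ) (hz : ∀ i < t, Measurable (z i)) :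
    Measurable fun ω =>
      A.stageIterate loss {v ∈ H | ‖v - w ω‖ ≤ Δ} γ (w ω) (fun i => z i ω) t := by
  induction t with
  | zero => exact hw
  | succ t ih =>
    have ih' := ih fun i hi => hz i (by omega)
    have hg := (continuous_clip hγ).measurable.comp
      (h.measurable_stochGrad.comp (ih'.prodMk (hz t (by omega))))
    exact measurable_metricProj h.compact h.risk_strongConvex.1 hΔ hw
      (ih'.sub (hg.const_smul A.stepSize)) hwH

lemma measurable_output (h : IsLearningProblem D loss H R α β) (hΔ : ∀ k, 0 < A.domainSize k)
    (hγ : 0 ≤ A.xi * A.beta) {z : ℕ → Ω → Vec d × Y} (k : ℕ)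
    (hz : ∀ i < k * A.stageSize, Measurable (z i)) :
    Measurable fun ω => A.output loss H (fun i => z i ω) k := by
  induction k with
  | zero => exact measurable_const
  | succ k ih =>
    have hk : (k + 1) * A.stageSize = k * A.stageSize + A.stageSize := by ring
    simp only [output]
    suffices hsum : Measurable fun ω => ∑ t ∈ Finset.range A.stageSize,
        A.stageIterate loss {v ∈ H | ‖v - A.output loss H (fun i => z i ω) k‖ ≤ A.domainSize k}
          (2 * A.xi * A.beta * A.domainSize k) (A.output loss H (fun i => z i ω) k)
          (fun i => z (k * A.stageSize + i) ω) t from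
      hsum.const_smul (1 / (A.stageSize : ℝ))
    refine Finset.measurable_fun_sum _ fun t ht => ?_
    have ht' := Finset.mem_range.1 ht
    refine measurable_stageIterate h (hΔ k) ?_ (ih fun i hi => hz i (by omega))
      (fun ω => output_mem h.compact.isClosed h.risk_strongConvex.1 h.zero_mem hΔ _ k) t
      (z := fun i => z (k * A.stageSize + i)) fun i hi => hz _ (by omega)
    have := (hΔ k).le
    rw [mul_assoc, mul_assoc, ← mul_assoc A.xi]
    positivity

end Measurability

end ClippedSGDInput

/-! ### One stage -/

section Stage

variable {d : ℕ} {Y : Type*} [MeasurableSpace Y] {D : Measure (Vec d × Y)} {loss : ℝ → Y → ℝ}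
  {H : Set (Vec d)} {R α β : ℝ} {A : ClippedSGDInput} {u : Vec d}

lemma IsLearningProblem.measurable_stepProgress (h : IsLearningProblem D loss H R α β) {γ : ℝ}
    (hγ : 0 ≤ γ) (η : ℝ) (u : Vec d) :
    Measurable fun q : Vec d × (Vec d × Y) => stepProgress loss γ η u q.1 q.2 := by
  have hclip := (continuous_clip hγ).measurable.comp h.measurable_stochGrad
  exact (hclip.inner (𝕜 := ℝ) (measurable_fst.sub_const u)).sub
    ((hclip.norm.pow_const 2).const_mul (η / 2))

/-- If the exponent of the supermartingale stays below `U` in a stage whose domain contains the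
minimizer `u`, then the average of the iterates has small excess risk. -/
lemma IsLearningProblem.excess_average_le (h : IsLearningProblem D loss H R α β) (hα : 0 < α)
    (hβ : 0 < β) {ξ Δ ε U εprior : ℝ} {n : ℕ} (hξ : 4 ≤ ξ) (hΔ : 0 < Δ) (hε : 0 < ε)
    (hd : 1 ≤ d) (hu : u ∈ H) (hmin : IsMinOn (risk D loss) H u) (hprior : risk D loss u ≤ εprior)
    (hη : A.stepSize = 1 / (2 * ξ * β * √n)) (hn : 0 < n)
    (hn1 : 4 * (ξ ^ 3 * β * d / (ε * α) * U) ≤ n)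
    (hn2 : 64 * ξ ^ 2 * β ^ 2 / (α ^ 2 * ε ^ 2) ≤ n)
    {w₀ : Vec d} (hw₀ : w₀ ∈ H) (hw₀u : ‖w₀ - u‖ ≤ Δ) {z : ℕ → Vec d × Y} {w : ℕ → Vec d}
    (hw : A.stageIterate loss {v ∈ H | ‖v - w₀‖ ≤ Δ} (2 * ξ * β * Δ) w₀ z = w)
    (hsum : ∑ t ∈ Finset.range n, 2 / (Δ ^ 2 * (ξ ^ 3 * β * d)) *
      ((1 - 2 / ξ) * risk D loss (w t) - risk D loss u
        - stepProgress loss (2 * ξ * β * Δ) A.stepSize u (w t) (z t)) ≤ U) :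
    risk D loss ((1 / (n : ℝ)) • ∑ t ∈ Finset.range n, w t) - risk D loss u
      ≤ α / 2 * (ε * Δ ^ 2) + 4 / ξ * εprior := by
  have hconv := h.risk_strongConvex.1
  have hξ0 : 0 < ξ := by linarith
  have hd' : (0 : ℝ) < d := by exact_mod_cast hd
  have hn' : (0 : ℝ) < n := by exact_mod_cast hn
  have hsn : 0 < √(n : ℝ) := Real.sqrt_pos.2 hn'
  have hη0 : 0 < A.stepSize := by rw [hη]; positivity
  have hwH : ∀ t, w t ∈ H := fun t => by
    rw [← hw]
    exact (ClippedSGDInput.stageIterate_mem (isClosed_sep_norm_sub_le h.compact.isClosed _ _)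
      ⟨hw₀, by simpa using hΔ.le⟩ z t).1
  have hreg := ClippedSGDInput.sum_stepProgress_le (loss := loss) (γ := 2 * ξ * β * Δ) (w₀ := w₀)
    hη0 (convex_sep_norm_sub_le hconv w₀ Δ) (isClosed_sep_norm_sub_le h.compact.isClosed w₀ Δ)
    (u := u) ⟨hu, by rwa [norm_sub_rev]⟩ z n
  rw [hw] at hreg
  set S := ∑ t ∈ Finset.range n, stepProgress loss (2 * ξ * β * Δ) A.stepSize u (w t) (z t)
  set L := ∑ t ∈ Finset.range n, risk D loss (w t) with hL
  set avg := (1 / (n : ℝ)) • ∑ t ∈ Finset.range n, w t with havg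
  have hsum' : 2 / (Δ ^ 2 * (ξ ^ 3 * β * d)) * ((1 - 2 / ξ) * L - n * risk D loss u - S) ≤ U := by
    rw [← Finset.mul_sum, Finset.sum_sub_distrib, Finset.sum_sub_distrib, ← Finset.mul_sum] at hsum
    simpa using hsum
  -- The deviation `U` and the initial distance each cost at most `n` times an eighth of `α ε Δ²`.
  have hdev : (1 - 2 / ξ) * L - n * risk D loss u - S ≤ n * (α * ε * Δ ^ 2 / 8) := by
    have h1 : (1 - 2 / ξ) * L - n * risk D loss u - S ≤ U * (Δ ^ 2 * (ξ ^ 3 * β * d)) / 2 := by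
      rw [div_mul_eq_mul_div, div_le_iff₀ (by positivity)] at hsum'
      linarith
    have h2 : U * (Δ ^ 2 * (ξ ^ 3 * β * d)) / 2
        = 4 * (ξ ^ 3 * β * d / (ε * α) * U) * (α * ε * Δ ^ 2 / 8) := by
      field_simp
      ring
    rw [h2] at h1
    exact h1.trans (by gcongr)
  have hopt : S ≤ n * (α * ε * Δ ^ 2 / 8) := by
    have h1 : ‖w₀ - u‖ ^ 2 / (2 * A.stepSize) ≤ Δ ^ 2 * (ξ * β * √n) := by
      rw [div_le_iff₀ (by positivity), hη]
      have : Δ ^ 2 * (ξ * β * √n) * (2 * (1 / (2 * ξ * β * √n))) = Δ ^ 2 := by field_simp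
      rw [this]
      gcongr
    have h2 : 8 * (ξ * β) ≤ √n * (α * ε) := by
      have h3 : 8 * ξ * β / (α * ε) ≤ √n := by
        apply Real.le_sqrt_of_sq_le
        refine le_trans (le_of_eq ?_) hn2
        field_simp
        norm_num
      rw [div_le_iff₀ (by positivity)] at h3
      linarith
    calc S ≤ Δ ^ 2 * (ξ * β * √n) := hreg.trans h1
      _ = (8 * (ξ * β)) * √n * Δ ^ 2 / 8 := by ring
      _ ≤ (√n * (α * ε)) * √n * Δ ^ 2 / 8 := by gcongr
      _ = (√n * √n) * (α * ε * Δ ^ 2 / 8) := by ring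
      _ = n * (α * ε * Δ ^ 2 / 8) := by rw [Real.mul_self_sqrt hn'.le]
  have hjensen : n * risk D loss avg ≤ L := by
    have hcx : ConvexOn ℝ H (risk D loss) := by
      rw [← strongConvexOn_zero]; exact h.risk_strongConvex.mono hα.le
    have h1 := hcx.map_sum_le (t := Finset.range n) (w := fun _ => 1 / (n : ℝ)) (p := w)
      (fun _ _ => by positivity) (by simp [hn'.ne']) (fun t _ => hwH t)
    rw [← Finset.smul_sum, ← Finset.smul_sum, smul_eq_mul] at h1
    rw [havg, hL]
    calc (n : ℝ) * risk D loss ((1 / (n : ℝ)) • ∑ t ∈ Finset.range n, w t)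
        ≤ n * (1 / n * ∑ t ∈ Finset.range n, risk D loss (w t)) := by gcongr
      _ = ∑ t ∈ Finset.range n, risk D loss (w t) := by field_simp
  have havgH : avg ∈ H := ClippedSGDInput.average_mem hconv hwH hn
  have hX : 0 ≤ risk D loss avg - risk D loss u := sub_nonneg.2 (hmin havgH)
  have hξ2 : 2 / ξ ≤ 1 / 2 := by rw [div_le_iff₀ hξ0]; linarith
  have hmain : (1 - 2 / ξ) * risk D loss avg - risk D loss u ≤ α * ε * Δ ^ 2 / 4 := by
    refine le_of_mul_le_mul_left ?_ hn'
    have := mul_le_mul_of_nonneg_left hjensen (by linarith : 0 ≤ 1 - 2 / ξ)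
    linarith
  have h4 : 4 / ξ = 2 * (2 / ξ) := by ring
  rw [h4]
  have h5 : 2 / ξ * risk D loss u ≤ 2 / ξ * εprior := by gcongr
  nlinarith [mul_nonneg (sub_nonneg.2 hξ2) hX]

/-- If the minimizer `u` lies in the domain of a stage, then the stage fails to contract the excess
risk with probability at most `exp (-U)`: Markov's inequality for the exponential
supermartingale. The domain of the stage is random, but the supermartingale only
involves the ball of radius `2 Δ` around `u`, which contains it. -/
lemma measure_stage_failure_le (h : IsLearningProblem D loss H R α β) (hα : 0 < α)
    (hβ : 0 < β) {ε U εprior : ℝ} {n : ℕ} (hξ : 4 ≤ A.xi) (hΔ : ∀ k, 0 < A.domainSize k)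
    (hε : 0 < ε) (hd : 1 ≤ d) (hu : u ∈ H) (hmin : IsMinOn (risk D loss) H u)
    (hprior : risk D loss u ≤ εprior) (hA : A.stageSize = n) (hAβ : A.beta = β)
    (hη : A.stepSize = 1 / (2 * A.xi * β * √n)) (hn : 16 ≤ n)
    (hn1 : 4 * (A.xi ^ 3 * β * d / (ε * α) * U) ≤ n)
    (hn2 : 64 * A.xi ^ 2 * β ^ 2 / (α ^ 2 * ε ^ 2) ≤ n)
    {Ω : Type*} [MeasurableSpace Ω] {P : Measure Ω} [IsProbabilityMeasure P]
    {Z : ℕ → Ω → Vec d × Y} (hZ : IsIIDSample P D Z) (k : ℕ) :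
    P {ω | ‖A.output loss H (fun i => Z i ω) k - u‖ ≤ A.domainSize k ∧
        α / 2 * (ε * A.domainSize k ^ 2) + 4 / A.xi * εprior
          < risk D loss (A.output loss H (fun i => Z i ω) (k + 1)) - risk D loss u}
      ≤ ENNReal.ofReal (Real.exp (-U)) := by
  subst hA hAβ
  set ξ := A.xi with hξdef
  set Δ := A.domainSize k with hΔdef
  have hΔ0 : 0 < Δ := hΔ k
  have hξ0 : 0 < ξ := by linarith
  have hγ : 0 ≤ 2 * ξ * A.beta * Δ := by positivity
  have hr : 4 ≤ √(A.stageSize : ℝ) := by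
    apply Real.le_sqrt_of_sq_le
    have : (16 : ℝ) ≤ A.stageSize := by exact_mod_cast hn
    linarith
  let q : Vec d × (Vec d × Y) → ℝ := fun p => 2 / (Δ ^ 2 * (ξ ^ 3 * A.beta * d)) *
    ((1 - 2 / ξ) * risk D loss p.1 - risk D loss u
      - stepProgress loss (2 * ξ * A.beta * Δ) A.stepSize u p.1 p.2)
  have hq : Measurable q := ((((h.measurable_risk.comp measurable_fst).const_mul _).sub_const _).sub
    (h.measurable_stepProgress hγ _ u)).const_mul _
  let B : Set (Vec d) := {w ∈ H | ‖w - u‖ ≤ 2 * Δ}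
  have hB : MeasurableSet B := (isClosed_sep_norm_sub_le h.compact.isClosed u _).measurableSet
  let f : Vec d → Vec d × Y → ENNReal := fun w z =>
    (Prod.fst ⁻¹' B).indicator (fun p => ENNReal.ofReal (Real.exp (q p))) (w, z)
  have hf : Measurable (Function.uncurry f) :=
    (hq.exp.ennreal_ofReal).indicator (measurable_fst hB)
  have hf1 : ∀ w, ∫⁻ z, f w z ∂D ≤ 1 := by
    intro w
    by_cases hw : w ∈ B
    · have := lintegral_exp_neg_stepProgress_le h hβ hξ hΔ0 hr hd hu hw.1 hw.2
      rw [← hη] at this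
      simpa [f, Set.indicator, hw, q] using this
    · simp [f, Set.indicator, hw]
  let W : ℕ → Ω → Vec d := fun t ω =>
    A.stageIterate loss {v ∈ H | ‖v - A.output loss H (fun i => Z i ω) k‖ ≤ Δ}
      (2 * ξ * A.beta * Δ) (A.output loss H (fun i => Z i ω) k)
      (fun i => Z (k * A.stageSize + i) ω) t
  have hout : ∀ ω k, A.output loss H (fun i => Z i ω) k ∈ H := fun ω k =>
    ClippedSGDInput.output_mem h.compact.isClosed h.risk_strongConvex.1 h.zero_mem hΔ _ k
  have hW : ∀ t, Measurable[pastSigma Z (k * A.stageSize + t)] (W t) := fun t =>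
    ClippedSGDInput.measurable_stageIterate (mΩ := pastSigma Z (k * A.stageSize + t)) h hΔ0 hγ
      (ClippedSGDInput.measurable_output (mΩ := pastSigma Z (k * A.stageSize + t)) h hΔ
        (by positivity) k (z := Z) fun i hi => measurable_pastSigma (by omega))
      (fun ω => hout ω k) (z := fun i => Z (k * A.stageSize + i)) t
      fun i hi => measurable_pastSigma (by omega)
  have hprod : Measurable fun ω =>
      ∏ t ∈ Finset.range A.stageSize, f (W t ω) (Z (k * A.stageSize + t) ω) :=
    Finset.measurable_fun_prod _ fun t _ =>
      hf.comp (((hW t).mono (hZ.pastSigma_le _) le_rfl).prodMk (hZ.measurable _))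
  have hU : ENNReal.ofReal (Real.exp U) ≠ 0 := by simp [Real.exp_pos]
  calc P _ ≤ P {ω | ENNReal.ofReal (Real.exp U)
        ≤ ∏ t ∈ Finset.range A.stageSize, f (W t ω) (Z (k * A.stageSize + t) ω)} := by
        refine measure_mono fun ω hω => ?_
        obtain ⟨hω1, hω2⟩ := hω
        have hWB : ∀ t, W t ω ∈ B := fun t => by
          obtain ⟨h1, h2⟩ := ClippedSGDInput.stageIterate_mem (A := A) (loss := loss)
            (γ := 2 * ξ * A.beta * Δ)
            (isClosed_sep_norm_sub_le h.compact.isClosed (A.output loss H (fun i => Z i ω) k) Δ)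
            (w₀ := A.output loss H (fun i => Z i ω) k) ⟨hout ω k, by simpa using hΔ0.le⟩
            (fun i => Z (k * A.stageSize + i) ω) t
          refine ⟨h1, ?_⟩
          calc ‖W t ω - u‖ ≤ ‖W t ω - A.output loss H (fun i => Z i ω) k‖
                + ‖A.output loss H (fun i => Z i ω) k - u‖ :=
              norm_sub_le_norm_sub_add_norm_sub _ _ _
            _ ≤ Δ + Δ := add_le_add h2 hω1
            _ = 2 * Δ := by ring
        have hfq : ∀ t, f (W t ω) (Z (k * A.stageSize + t) ω)
            = ENNReal.ofReal (Real.exp (q (W t ω, Z (k * A.stageSize + t) ω))) := fun t => by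
          simp [f, Set.indicator, hWB t]
        simp only [Set.mem_ofPred_eq, hfq]
        rw [← ENNReal.ofReal_prod_of_nonneg fun _ _ => (Real.exp_pos _).le, ← Real.exp_sum]
        by_contra hcon
        refine hω2.not_ge (h.excess_average_le hα hβ hξ hΔ0 hε hd hu hmin hprior hη (by omega) hn1
          hn2 (hout ω k) hω1 rfl ?_)
        by_contra hcon'
        exact hcon (ENNReal.ofReal_le_ofReal (Real.exp_le_exp.2 (not_le.1 hcon').le))
    _ ≤ (∫⁻ ω, ∏ t ∈ Finset.range A.stageSize, f (W t ω) (Z (k * A.stageSize + t) ω) ∂P)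
          / ENNReal.ofReal (Real.exp U) :=
        meas_ge_le_lintegral_div hprod.aemeasurable hU ENNReal.ofReal_ne_top
    _ ≤ 1 / ENNReal.ofReal (Real.exp U) := by
        gcongr
        exact hZ.lintegral_prod_le_one hf hf1 hW _
    _ = ENNReal.ofReal (Real.exp (-U)) := by
        rw [Real.exp_neg, ENNReal.ofReal_inv_of_pos (Real.exp_pos _), one_div]

end Stage

/-! ### The convergence rate -/

section Rate

variable {d : ℕ} {α β R τ ε εprior δ : ℝ} {m n : ℕ}

lemma four_le_xiParam (hα : 0 < α) (hαβ : α ≤ β) (hτ : 0 < τ) (hτ1 : τ < 1) :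
    4 ≤ xiParam α β τ := by
  rw [xiParam, le_div_iff₀ (by positivity)]
  nlinarith

lemma tunedInput_domainSize_pos (hβ : 0 < β) (hR : 0 < R) (hτ : 0 < τ) (hε : 0 < ε)
    (hprior : 0 < εprior) (k : ℕ) : 0 < (tunedInput α β R τ ε εprior n).domainSize k :=
  ClippedSGDInput.domainSize_pos hR hβ hτ hε hprior k

/-- The contraction argument: outside an event of probability at most `δ`, no stage fails, and then
the minimizer stays in all domains, since the excess risk after a stage controls the
distance to the minimizer. -/
lemma measure_lt_risk_output_le (hα : 0 < α) (hαβ : α ≤ β) (hR : 0 < R) (hτ : 0 < τ) (hτ1 : τ < 1)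
    (hε : 0 < ε) (hε1 : ε < 1) (hprior : 0 < εprior) (hδ : 0 < δ) (hm : 1 ≤ m) (hd : 1 ≤ d)
    (hn1 : 4 * (xiParam α β τ ^ 3 * β * d / (ε * α) * Real.log (m / δ)) ≤ n)
    (hn2 : 64 * xiParam α β τ ^ 2 * β ^ 2 / (α ^ 2 * ε ^ 2) ≤ n)
    {Y : Type*} [MeasurableSpace Y] {D : Measure (Vec d × Y)} {loss : ℝ → Y → ℝ}
    {H : Set (Vec d)} (h : IsLearningProblem D loss H R α β) (hopt : optRisk D loss H ≤ εprior)
    {Ω : Type*} [MeasurableSpace Ω] {P : Measure Ω} [IsProbabilityMeasure P]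
    {Z : ℕ → Ω → Vec d × Y} (hZ : IsIIDSample P D Z) :
    P {ω | risk D loss ((tunedInput α β R τ ε εprior n).output loss H (fun i => Z i ω) m)
      ≤ β * R ^ 2 / 2 * ε ^ m + (1 + τ / (1 - ε)) * εprior}ᶜ ≤ ENNReal.ofReal δ := by
  have hβ : 0 < β := hα.trans_le hαβ
  set A := tunedInput α β R τ ε εprior n with hA
  set ξ := xiParam α β τ with hξdef
  have hξ : 4 ≤ ξ := four_le_xiParam hα hαβ hτ hτ1
  have hm0 : (0 : ℝ) < m := by exact_mod_cast hm
  have hΔ : ∀ k, 0 < A.domainSize k := tunedInput_domainSize_pos hβ hR hτ hε hprior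
  obtain ⟨u, hu, hmin, hur⟩ := h.exists_minimizer hβ
  have hup : risk D loss u ≤ εprior := hur.trans_le hopt
  have hn : 16 ≤ n := by
    have h1 : (64 : ℝ) ≤ 64 * ξ ^ 2 * β ^ 2 / (α ^ 2 * ε ^ 2) := by
      rw [le_div_iff₀ (by positivity)]
      have h2 : α * ε ≤ ξ * β := by nlinarith
      have h3 : (α * ε) ^ 2 ≤ (ξ * β) ^ 2 := by gcongr
      nlinarith
    have : (16 : ℝ) ≤ n := by linarith
    exact_mod_cast this
  let bad : ℕ → Set Ω := fun k => {ω |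
    ‖A.output loss H (fun i => Z i ω) k - u‖ ≤ A.domainSize k ∧
      α / 2 * (ε * A.domainSize k ^ 2) + 4 / ξ * εprior
        < risk D loss (A.output loss H (fun i => Z i ω) (k + 1)) - risk D loss u}
  have hbad : ∀ k, P (bad k) ≤ ENNReal.ofReal (δ / m) := by
    intro k
    have h1 := measure_stage_failure_le (A := A) h hα hβ hξ hΔ hε hd hu hmin hup rfl rfl rfl hn
      hn1 hn2 hZ k
    rwa [← Real.log_inv, Real.exp_log (by positivity), inv_div] at h1
  have hrec : ∀ k, A.domainSize (k + 1) ^ 2 = ε * A.domainSize k ^ 2 + 2 * τ / β * εprior :=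
    ClippedSGDInput.domainSize_succ_sq (A := A) hβ hτ hε hprior
  -- The prescribed value of `ξ` makes the allowed excess equal to `α / 2` times the next `Δ²`.
  have hbudget : ∀ k, α / 2 * (ε * A.domainSize k ^ 2) + 4 / ξ * εprior
      = α / 2 * A.domainSize (k + 1) ^ 2 := by
    intro k
    rw [hrec, hξdef, xiParam]
    field_simp
  have hsub : {ω | risk D loss (A.output loss H (fun i => Z i ω) m)
      ≤ β * R ^ 2 / 2 * ε ^ m + (1 + τ / (1 - ε)) * εprior}ᶜ
      ⊆ ⋃ k ∈ Finset.range m, bad k := by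
    intro ω hω
    by_contra hgood
    simp only [Set.mem_iUnion, Finset.mem_range, not_exists] at hgood
    have hexc : ∀ k < m, ‖A.output loss H (fun i => Z i ω) k - u‖ ≤ A.domainSize k →
        risk D loss (A.output loss H (fun i => Z i ω) (k + 1)) - risk D loss u
          ≤ α / 2 * A.domainSize (k + 1) ^ 2 := by
      intro k hk hdist
      rw [← hbudget]
      by_contra hcon
      exact hgood k hk ⟨hdist, not_le.1 hcon⟩
    have hdist : ∀ k ≤ m, ‖A.output loss H (fun i => Z i ω) k - u‖ ≤ A.domainSize k := by
      intro k
      induction k with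
      | zero =>
        intro _
        have h0 : A.output loss H (fun i => Z i ω) 0 = 0 := rfl
        rw [h0, zero_sub, norm_neg]
        exact h.bounded u hu
      | succ k ih =>
        intro hk
        have h1 := hexc k hk (ih (by omega))
        have h2 := h.mul_norm_sub_sq_le hu hmin (ClippedSGDInput.output_mem (loss := loss)
          h.compact.isClosed h.risk_strongConvex.1 h.zero_mem hΔ (fun i => Z i ω) (k + 1))
        have h3 := le_of_mul_le_mul_left (h2.trans h1) (by positivity)
        exact (sq_le_sq₀ (norm_nonneg _) (hΔ _).le).1 h3
    obtain ⟨k, rfl⟩ : ∃ k, m = k + 1 := ⟨m - 1, by omega⟩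
    refine hω ?_
    have h1 := hexc k (by omega) (hdist k (by omega))
    have h2 : α / 2 * A.domainSize (k + 1) ^ 2 ≤ β / 2 * A.domainSize (k + 1) ^ 2 := by gcongr
    have h3 : β / 2 * A.domainSize (k + 1) ^ 2
        ≤ β * R ^ 2 / 2 * ε ^ (k + 1) + τ / (1 - ε) * εprior :=
      ClippedSGDInput.domainSize_sq_le (A := A) hβ hτ hε hε1 hprior (k + 1)
    change risk D loss (A.output loss H (fun i => Z i ω) (k + 1)) ≤ _
    linarith
  calc P _ ≤ P (⋃ k ∈ Finset.range m, bad k) := measure_mono hsub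
    _ ≤ ∑ k ∈ Finset.range m, P (bad k) := measure_biUnion_finset_le _ _
    _ ≤ ∑ _k ∈ Finset.range m, ENNReal.ofReal (δ / m) := Finset.sum_le_sum fun k _ => hbad k
    _ = ENNReal.ofReal δ := by
        rw [Finset.sum_const, Finset.card_range, nsmul_eq_mul, ← ENNReal.ofReal_natCast,
          ← ENNReal.ofReal_mul hm0.le]
        congr 1
        field_simp

/-- If `H` is trivial then so is the output, which is then optimal. -/
lemma risk_output_le_of_subset_zero (hβ : 0 < β) (hR : 0 < R) (hτ : 0 < τ) (hε : 0 < ε)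
    (hprior : 0 < εprior) {Y : Type*} [MeasurableSpace Y] {D : Measure (Vec d × Y)}
    {loss : ℝ → Y → ℝ} {H : Set (Vec d)} (h : IsLearningProblem D loss H R α β)
    (hopt : optRisk D loss H ≤ εprior) (hH : ∀ w ∈ H, w = 0) (z : ℕ → Vec d × Y) (k : ℕ) :
    risk D loss ((tunedInput α β R τ ε εprior n).output loss H z k) ≤ εprior := by
  obtain ⟨u, hu, -, hur⟩ := h.exists_minimizer hβ
  rw [hH _ (ClippedSGDInput.output_mem h.compact.isClosed h.risk_strongConvex.1 h.zero_mem
    (tunedInput_domainSize_pos hβ hR hτ hε hprior) z k), ← hH u hu, hur]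
  exact hopt

/-- The degenerate parameters admit the trivial class only. -/
lemma IsLearningProblem.eq_zero_of_not_le (hβ : 0 < β) {Y : Type*} [MeasurableSpace Y]
    {D : Measure (Vec d × Y)} {loss : ℝ → Y → ℝ} {H : Set (Vec d)}
    (h : IsLearningProblem D loss H R α β) (hd : ¬ (1 ≤ d ∧ α ≤ β)) : ∀ w ∈ H, w = 0 := by
  intro w hw
  by_contra hw0
  refine hd ⟨?_, h.strongConvexity_le_smoothness hβ hw hw0⟩
  by_contra hd0
  obtain rfl : d = 0 := by omega
  exact hw0 (Subsingleton.elim _ _)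

/-- The convergence rate for every stage size satisfying two lower bounds that involve the number
of stages through `log (m / δ)` only. -/
theorem one_sub_le_prob_risk_output (hα : 0 < α) (hβ : 0 < β) (hR : 0 < R) (hτ : 0 < τ)
    (hτ1 : τ < 1) (hε : 0 < ε) (hε1 : ε < 1) (hprior : 0 < εprior) (hδ : 0 < δ) (hm : 1 ≤ m)
    (hn1 : 4 * (xiParam α β τ ^ 3 * β * d / (ε * α) * Real.log (m / δ)) ≤ n)
    (hn2 : 64 * xiParam α β τ ^ 2 * β ^ 2 / (α ^ 2 * ε ^ 2) ≤ n)
    {Y : Type*} [MeasurableSpace Y] {D : Measure (Vec d × Y)} {loss : ℝ → Y → ℝ}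
    {H : Set (Vec d)} (h : IsLearningProblem D loss H R α β) (hopt : optRisk D loss H ≤ εprior)
    {Ω : Type*} [MeasurableSpace Ω] {P : Measure Ω} [IsProbabilityMeasure P]
    {Z : ℕ → Ω → Vec d × Y} (hZ : IsIIDSample P D Z) :
    1 - δ ≤ P.real {ω |
      risk D loss ((tunedInput α β R τ ε εprior n).output loss H (fun i => Z i ω) m)
        ≤ β * R ^ 2 / 2 * ε ^ m + (1 + τ / (1 - ε)) * εprior} := by
  set S := {ω | risk D loss ((tunedInput α β R τ ε εprior n).output loss H (fun i => Z i ω) m)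
    ≤ β * R ^ 2 / 2 * ε ^ m + (1 + τ / (1 - ε)) * εprior} with hS
  by_cases hd : 1 ≤ d ∧ α ≤ β
  · have hc := measure_lt_risk_output_le hα hd.2 hR hτ hτ1 hε hε1 hprior hδ hm hd.1 hn1 hn2 h
      hopt hZ
    have h1 : P.real Sᶜ ≤ δ := ENNReal.toReal_le_of_le_ofReal hδ.le hc
    have h2 : 1 ≤ P.real S + P.real Sᶜ := by
      have := measureReal_union_le (μ := P) S Sᶜ
      rwa [Set.union_compl_self, probReal_univ] at this
    linarith
  · have : S = Set.univ := Set.eq_univ_of_forall fun ω => by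
      refine (risk_output_le_of_subset_zero hβ hR hτ hε hprior h hopt
        (h.eq_zero_of_not_le hβ hd) _ m).trans ?_
      have h1 : 0 < 1 - ε := by linarith
      have h2 : 0 ≤ β * R ^ 2 / 2 * ε ^ m := by positivity
      have h3 : 0 ≤ τ / (1 - ε) * εprior := by positivity
      linarith
    rw [this, probReal_univ]
    linarith

end Rate

lemma le_of_stageSizeParam_le {d m n : ℕ} {α β R τ ε εprior δ : ℝ} (hα : 0 < α) (hβ : 0 < β)
    (hτ : 0 < τ) (hε : 0 < ε) (hδ : 0 < δ) (hδ1 : δ < 1) (hm : 1 ≤ m)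
    (hn : stageSizeParam d m α β R τ ε εprior δ ≤ (n : ℝ)) :
    4 * (xiParam α β τ ^ 3 * β * d / (ε * α) * Real.log (m / δ)) ≤ n ∧
      64 * xiParam α β τ ^ 2 * β ^ 2 / (α ^ 2 * ε ^ 2) ≤ n := by
  have hξ : 0 < xiParam α β τ := by rw [xiParam]; positivity
  have hm1 : (1 : ℝ) ≤ m := by exact_mod_cast hm
  have hs : (1 : ℝ) ≤ sParam α β R τ εprior := by exact_mod_cast le_max_left _ _
  have hlog0 : 0 ≤ Real.log (m / δ) := Real.log_nonneg (by rw [le_div_iff₀ hδ]; linarith)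
  rw [stageSizeParam] at hn
  constructor
  · refine le_trans ?_ hn
    gcongr
    refine le_trans ?_ (le_max_left _ _)
    gcongr
    · exact le_add_of_nonneg_right (by positivity)
    · exact le_mul_of_one_le_right (by positivity) hs
  · refine le_trans (le_of_eq ?_) ((mul_le_mul_of_nonneg_left (le_max_right _ _)
      (by norm_num : (0 : ℝ) ≤ 4)).trans hn)
    ring

/-! ### The sample complexity -/

lemma mul_exp_le_two_pow {x l : ℝ} {m : ℕ} (hx : 0 ≤ x) (hl : 1 ≤ l)
    (hm : 2 * (1 + x) * l ≤ m) : x * Real.exp l ≤ 2 ^ m := by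
  have h2 : (1 : ℝ) / 2 ≤ Real.log 2 := by
    have := Real.log_two_gt_d9
    linarith
  have h3 : x + l ≤ m * Real.log 2 := by
    have h4 : x * 1 ≤ x * l := by gcongr
    have h5 : (m : ℝ) * (1 / 2) ≤ m * Real.log 2 := by gcongr
    linarith
  calc x * Real.exp l ≤ Real.exp x * Real.exp l := by
        gcongr
        linarith [Real.add_one_le_exp x]
    _ = Real.exp (x + l) := (Real.exp_add _ _).symm
    _ ≤ Real.exp (m * Real.log 2) := Real.exp_le_exp.2 h3
    _ = 2 ^ m := by rw [mul_comm, Real.exp_mul, Real.exp_log two_pos, Real.rpow_natCast]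

/-- The choice of the number of stages and of the stage size: `m` is proportional to
`log (1 / εprior)`, so that the initial error is contracted below the target, and `n` is the least
stage size allowed by the convergence rate. -/
lemma exists_stages {τ B : ℝ} (hτ : 0 < τ) (hB : 0 < B) :
    ∃ C : ℝ, 0 < C ∧ ∀ (d : ℕ) (α β R εprior δ : ℝ) (T : ℕ),
      0 < α → α ≤ β → 1 ≤ d → β * R ^ 2 ≤ B → 0 < εprior → εprior ≤ 1 / 16 → 0 < δ → δ < 1 →
      C * (d * (β / α) ^ 4 *
        (Real.log (1 / εprior) * (Real.log (Real.log (1 / εprior)) + Real.log (1 / δ))))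
          ≤ (T : ℝ) →
      ∃ m n : ℕ, m * n ≤ T ∧ 1 ≤ m ∧
        4 * (xiParam α β τ ^ 3 * β * d / (1 / 2 * α) * Real.log (m / δ)) ≤ n ∧
        64 * xiParam α β τ ^ 2 * β ^ 2 / (α ^ 2 * (1 / 2) ^ 2) ≤ n ∧
        β * R ^ 2 / 2 * (1 / 2) ^ m ≤ τ * εprior := by
  set K := 2 * (1 + B / (2 * τ)) with hK
  have hK0 : 0 < K := by positivity
  refine ⟨(K + 1) * (1 + 512 / τ ^ 3 * (K + 1) + 4096 / τ ^ 2), by positivity, ?_⟩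
  intro d α β R εprior δ T hα hαβ hd hBR hp hp16 hδ hδ1 hT
  have hβ : 0 < β := hα.trans_le hαβ
  have hd' : (1 : ℝ) ≤ d := by exact_mod_cast hd
  set κ := β / α with hκ
  have hκ1 : 1 ≤ κ := (one_le_div hα).2 hαβ
  set l := Real.log (1 / εprior) with hl
  have he1 : Real.exp 1 < 2.7182818286 := Real.exp_one_lt_d9
  -- `log (1 / εprior) ≥ log 16 = 4 log 2 > e`, so that its logarithm is at least one.
  have hle : Real.exp 1 ≤ l := by
    have h16 : Real.log 16 ≤ l := by
      refine Real.log_le_log (by norm_num) ?_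
      rw [le_div_iff₀ hp]
      linarith
    have h2 : Real.log 16 = 4 * Real.log 2 := by
      rw [show (16 : ℝ) = 2 ^ 4 by norm_num, Real.log_pow]; norm_num
    have := Real.log_two_gt_d9
    linarith
  have hl1 : 1 ≤ l := (Real.one_le_exp zero_le_one).trans hle
  have hl0 : 0 < l := by linarith
  have hll : 1 ≤ Real.log l := by rwa [Real.le_log_iff_exp_le hl0]
  have hlδ : 0 ≤ Real.log (1 / δ) := Real.log_nonneg (by rw [le_div_iff₀ hδ]; linarith)
  set Λ := Real.log l + Real.log (1 / δ) with hΛ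
  have hΛ1 : 1 ≤ Λ := by linarith
  set m := ⌈K * l⌉₊ with hm
  set a := 4 * (xiParam α β τ ^ 3 * β * d / (1 / 2 * α) * Real.log (m / δ)) with ha
  set b := 64 * xiParam α β τ ^ 2 * β ^ 2 / (α ^ 2 * (1 / 2) ^ 2) with hb
  have hm1 : 1 ≤ m := Nat.one_le_ceil_iff.2 (by positivity)
  have hm1' : (1 : ℝ) ≤ m := by exact_mod_cast hm1
  have hmK : (m : ℝ) ≤ (K + 1) * l := by
    have := (Nat.ceil_lt_add_one (by positivity : 0 ≤ K * l)).le
    rw [← hm] at this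
    linarith
  have hlogm : Real.log (m / δ) ≤ (K + 1) * Λ := by
    have h1 : Real.log (m / δ) = Real.log m + Real.log (1 / δ) := by
      rw [← Real.log_mul (by positivity) (by positivity)]; ring_nf
    have h2 : Real.log m ≤ K + Real.log l := by
      calc Real.log m ≤ Real.log ((K + 1) * l) := Real.log_le_log (by positivity) hmK
        _ = Real.log (K + 1) + Real.log l := Real.log_mul (by positivity) hl0.ne'
        _ ≤ K + Real.log l := by
            have := Real.log_le_sub_one_of_pos (by positivity : 0 < K + 1)
            linarith
    rw [h1, hΛ]
    nlinarith
  have hlogm0 : 0 ≤ Real.log (m / δ) := Real.log_nonneg (by rw [le_div_iff₀ hδ]; linarith)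
  set Q := d * κ ^ 4 * Λ with hQ
  have hκ4 : 1 ≤ κ ^ 4 := one_le_pow₀ hκ1
  have hQ1 : κ ^ 4 ≤ Q := by
    rw [hQ]
    calc κ ^ 4 = 1 * κ ^ 4 * 1 := by ring
      _ ≤ d * κ ^ 4 * Λ := by gcongr
  have ha' : a ≤ 512 / τ ^ 3 * (K + 1) * Q := by
    calc a = 512 / τ ^ 3 * (d * κ ^ 4) * Real.log (m / δ) := by
          rw [ha, xiParam, hκ]; field_simp; ring
      _ ≤ 512 / τ ^ 3 * (d * κ ^ 4) * ((K + 1) * Λ) := by gcongr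
      _ = 512 / τ ^ 3 * (K + 1) * Q := by rw [hQ]; ring
  have ha0 : 0 ≤ a := by
    have : 0 < xiParam α β τ := by rw [xiParam]; positivity
    positivity
  have hb' : b ≤ 4096 / τ ^ 2 * Q := by
    calc b = 4096 / τ ^ 2 * κ ^ 4 := by rw [hb, xiParam, hκ]; field_simp; norm_num
      _ ≤ 4096 / τ ^ 2 * Q := by gcongr
  have hb0 : 0 ≤ b := by positivity
  refine ⟨m, ⌈a + b⌉₊, ?_, hm1, (by linarith : a ≤ a + b).trans (Nat.le_ceil _),
    (by linarith : b ≤ a + b).trans (Nat.le_ceil _), ?_⟩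
  · have hn : ((⌈a + b⌉₊ : ℕ) : ℝ) ≤ (1 + 512 / τ ^ 3 * (K + 1) + 4096 / τ ^ 2) * Q := by
      have := (Nat.ceil_lt_add_one (by positivity : 0 ≤ a + b)).le
      linarith
    have : (m : ℝ) * (⌈a + b⌉₊ : ℕ) ≤ T := by
      calc (m : ℝ) * (⌈a + b⌉₊ : ℕ)
          ≤ ((K + 1) * l) * ((1 + 512 / τ ^ 3 * (K + 1) + 4096 / τ ^ 2) * Q) := by gcongr
        _ = (K + 1) * (1 + 512 / τ ^ 3 * (K + 1) + 4096 / τ ^ 2) * (d * κ ^ 4 * (l * Λ)) := by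
            rw [hQ]; ring
        _ ≤ T := hT
    exact_mod_cast this
  · have h1 : B / (2 * τ) / εprior ≤ 2 ^ m := by
      have := mul_exp_le_two_pow (by positivity : 0 ≤ B / (2 * τ)) hl1 (Nat.le_ceil (K * l))
      rwa [hl, Real.exp_log (by positivity), mul_one_div] at this
    rw [one_div, inv_pow, ← div_eq_mul_inv, div_le_iff₀ (by positivity)]
    rw [div_le_iff₀ hp, div_le_iff₀ (by positivity)] at h1
    linarith

theorem mainTheorem1 :
    -- Convergence rate, for every stage size that is at least the prescribed one.
    (∀ (d : ℕ) (α β R τ ε εprior δ : ℝ) (m n : ℕ),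
      0 < α → 0 < β → 0 < R → 0 < τ → τ < 1 → 0 < ε → ε < 1 → 0 < εprior → 0 < δ → δ < 1 →
      1 ≤ m → stageSizeParam d m α β R τ ε εprior δ ≤ (n : ℝ) →
      ∀ (Y : Type*) [MeasurableSpace Y] (D : Measure (Vec d × Y)) (loss : ℝ → Y → ℝ)
        (H : Set (Vec d)),
        IsLearningProblem D loss H R α β → optRisk D loss H ≤ εprior →
        ∀ (Ω : Type*) [MeasurableSpace Ω] (P : Measure Ω) [IsProbabilityMeasure P]
          (Z : ℕ → Ω → Vec d × Y), IsIIDSample P D Z →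
          1 - δ ≤ P.real {ω |
            risk D loss ((tunedInput α β R τ ε εprior n).output loss H (fun i => Z i ω) m)
              ≤ β * R ^ 2 / 2 * ε ^ m + (1 + τ / (1 - ε)) * εprior}) ∧
    -- Sample complexity, with `ε = 1 / 2`, for every target accuracy `c`.
    (∀ c : ℝ, 0 < c → ∃ τ : ℝ, 0 < τ ∧ τ < 1 ∧ ∀ B : ℝ, 0 < B → ∃ C : ℝ, 0 < C ∧
      ∀ (d : ℕ) (α β R εprior δ : ℝ) (T : ℕ),
        0 < α → 0 < β → 0 < R → β * R ^ 2 ≤ B → 0 < εprior → εprior ≤ 1 / 16 → 0 < δ → δ < 1 →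
        C * (d * (β / α) ^ 4 *
          (Real.log (1 / εprior) * (Real.log (Real.log (1 / εprior)) + Real.log (1 / δ))))
            ≤ (T : ℝ) →
        ∃ m n : ℕ, m * n ≤ T ∧
          ∀ (Y : Type*) [MeasurableSpace Y] (D : Measure (Vec d × Y)) (loss : ℝ → Y → ℝ)
            (H : Set (Vec d)),
            IsLearningProblem D loss H R α β → optRisk D loss H ≤ εprior →
            ∀ (Ω : Type*) [MeasurableSpace Ω] (P : Measure Ω) [IsProbabilityMeasure P]
              (Z : ℕ → Ω → Vec d × Y), IsIIDSample P D Z →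
              1 - δ ≤ P.real {ω |
                risk D loss
                    ((tunedInput α β R τ (1 / 2) εprior n).output loss H (fun i => Z i ω) m)
                  ≤ (1 + c) * εprior}) := by
  refine ⟨?_, ?_⟩
  · intro d α β R τ ε εprior δ m n hα hβ hR hτ hτ1 hε hε1 hprior hδ hδ1 hm hn
      Y _ D loss H h hopt Ω _ P _ Z hZ
    obtain ⟨hn1, hn2⟩ := le_of_stageSizeParam_le hα hβ hτ hε hδ hδ1 hm hn
    exact one_sub_le_prob_risk_output hα hβ hR hτ hτ1 hε hε1 hprior hδ hm hn1 hn2 h hopt hZ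
  · intro c hc
    -- The final error is at most `(τ + 1 + 2 τ) εprior`.
    set τ := min (c / 4) (1 / 2) with hτdef
    have hτ : 0 < τ := lt_min (by linarith) (by norm_num)
    have hτ1 : τ < 1 := (min_le_right _ _).trans_lt (by norm_num)
    have hτc : τ ≤ c / 4 := min_le_left _ _
    refine ⟨τ, hτ, hτ1, fun B hB => ?_⟩
    obtain ⟨C, hC, hstages⟩ := exists_stages hτ hB
    refine ⟨C, hC, ?_⟩
    intro d α β R εprior δ T hα hβ hR hBR hprior hprior16 hδ hδ1 hT
    by_cases hd : 1 ≤ d ∧ α ≤ β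
    · obtain ⟨m, n, hmn, hm, hn1, hn2, hinit⟩ :=
        hstages d α β R εprior δ T hα hd.2 hd.1 hBR hprior hprior16 hδ hδ1 hT
      refine ⟨m, n, hmn, ?_⟩
      intro Y _ D loss H h hopt Ω _ P _ Z hZ
      refine (one_sub_le_prob_risk_output hα hβ hR hτ hτ1 (by norm_num) (by norm_num) hprior hδ hm
        hn1 hn2 h hopt hZ).trans (measureReal_mono fun ω hω => ?_)
      refine le_trans (Set.mem_ofPred_eq ▸ hω) ?_
      have h2 : τ / (1 - 1 / 2) = 2 * τ := by ring
      rw [h2]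
      nlinarith
    -- Only the trivial class `{0}` is possible, for which no examples are needed.
    · refine ⟨0, 0, by simp, ?_⟩
      intro Y _ D loss H h hopt Ω _ P _ Z hZ
      have huniv : {ω | risk D loss
          ((tunedInput α β R τ (1 / 2) εprior 0).output loss H (fun i => Z i ω) 0)
            ≤ (1 + c) * εprior} = Set.univ := Set.eq_univ_of_forall fun ω => by
        refine (risk_output_le_of_subset_zero hβ hR hτ (by norm_num) hprior h hopt
          (h.eq_zero_of_not_le hβ hd) _ 0).trans ?_
        nlinarith
      rw [huniv, probReal_univ]
      linarith
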